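/- Let $(W,S)$ be a Coxeter system ($S$ of arbitrary cardinality), with identity $e$, and regard $W$ as a poset under the Bruhat order. In a poset write $x\lhd y$ if $y$ covers $x$, and $\mathrm{coat}(y)=\{x : x\lhd y\}$. A \emph{(distinguished) matching} of a poset $P$ is a map $\phi:P\to P$ such that $\phi\circ\phi=\mathrm{id}$; for all $u\in P$, $u\lhd\phi(u)$ or $\phi(u)\lhd u$; and for all $u\in P$ with $u\lhd\phi(u)$, $$\mathrm{coat}(\phi(u))=\{u\}\cup\{\phi(v) : v\lhd u,\ v\lhd\phi(v)\}.$$ A \emph{partial matching} of $P$ is a pair $(Q,\phi)$ where $Q\subseteq P$ is closed downwards and $\phi:Q\to Q$ is a matching of the sub-poset $Q$. Partial matchings are ordered by extension, and a \emph{maximal matching} on $P$ is a maximal element for this order. If $S\neq\emptyset$ and $(Q,\phi)$ is a maximal matching on $W$, then $e\in Q$ and $a=\phi(e)$ belongs to $S$. For $a\in S$ and $s\in S\setminus\{a\}$ put $P_s=\langle s,a\rangle$ (the principal dihedral subgroups), with the induced order. (i) For every maximal matching $(Q,\phi)$ on $W$ with $\phi(e)=a$ and every $s\in S\setminus\{a\}$,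 one has $P_s\subseteq Q$, $\phi(P_s)\subseteq P_s$, and the induced map $\phi|_{P_s}:P_s\to P_s$ is a matching of $P_s$. (ii) Conversely, let $a\in S$ and let $(\alpha_s)_{s\in S\setminus\{a\}}$ be a family where each $\alpha_s$ is a matching of $P_s$ with $\alpha_s(e)=a$. Then there is a unique maximal matching $(Q,\phi)$ on $W$ such that $P_s\subseteq Q$ and $\phi|_{P_s}=\alpha_s$ for all $s\in S\setminus\{a\}$. Consequently, for each $a\in S$, the map $\phi\mapsto(\phi|_{P_s})_{s\in S\setminus\{a\}}$ is a bijection from the set of maximal matchings $\phi$ on $W$ with $\phi(e)=a$ onto the product over $s\in S\setminus\{a\}$ of the sets of matchings $\alpha_s$ of $P_s$ with $\alpha_s(e)=a$. -/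

import Mathlib

/-- `coat y`: the set of elements covered by `y`. -/
def coat {P : Type*} [PartialOrder P] (y : P) : Set P := {x | x ⋖ y}

/-- Distinguished (special) matchings `φ` of a poset `P`. -/
structure IsDistinguishedMatching {P : Type*} [PartialOrder P] (φ : P → P) : Prop where
  involutive : ∀ u, φ (φ u) = u
  covBy_or_covBy : ∀ u, u ⋖ φ u ∨ φ u ⋖ u
  coat_eq : ∀ u, u ⋖ φ u → coat (φ u) = {u} ∪ {x | ∃ v, v ⋖ u ∧ v ⋖ φ v ∧ x = φ v}

/-- A partial matching of `P`: a down-closed subset `dom` of `P`, possibly empty, together with a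
distinguished matching of the sub-poset `dom`. -/
structure PartialMatching (P : Type*) [PartialOrder P] where
  dom : LowerSet P
  toFun : dom → dom
  isMatching : IsDistinguishedMatching toFun

namespace PartialMatching

variable {P : Type*} [PartialOrder P]

/-- `φ.Maps x y`: `φ` is defined at `x`, with value `y`. -/
def Maps (φ : PartialMatching P) (x y : P) : Prop :=
  ∃ h : x ∈ φ.dom, (φ.toFun ⟨x, h⟩ : P) = y

/-- `φ.RestrictsTo D f`: `φ` is defined on all of `D`, the set `D` is stable under `φ`, and the
induced map `D → D` is `f`. -/
def RestrictsTo (φ : PartialMatching P) (D : Set P) (f : D → D) : Prop :=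
  ∀ x : D, φ.Maps x (f x)

/-- The order on partial matchings: `φ ≤ ψ` iff `ψ` extends `φ`. -/
instance : PartialOrder (PartialMatching P) where
  le φ ψ := ∀ x : φ.dom, ψ.Maps x (φ.toFun x)
  le_refl φ := fun x => ⟨x.2, rfl⟩
  le_trans φ ψ χ h₁ h₂ := fun x => by
    obtain ⟨h, e⟩ := h₁ x
    obtain ⟨h', e'⟩ := h₂ ⟨x, h⟩
    exact ⟨h', e'.trans e⟩
  le_antisymm φ ψ h₁ h₂ := by
    obtain ⟨Q, f, hf⟩ := φ
    obtain ⟨R, g, hg⟩ := ψ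
    have hQR : Q = R := le_antisymm (fun x hx => (h₁ ⟨x, hx⟩).1) (fun x hx => (h₂ ⟨x, hx⟩).1)
    subst hQR
    have hfg : f = g := funext fun x => Subtype.ext (h₁ x).2.symm
    subst hfg
    rfl

end PartialMatching

namespace CoxeterSystem

variable {B W : Type*} [Group W] {M : CoxeterMatrix B}

/-- An elementary step of the Bruhat order: `w = u t` with `t` a reflection and `ℓ(u) < ℓ(w)`. -/
def BruhatStep (cs : CoxeterSystem M W) (u w : W) : Prop :=
  (∃ t, cs.IsReflection t ∧ w = u * t) ∧ cs.length u < cs.length w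

/-- The Bruhat order of a Coxeter system. -/
@[reducible] def bruhatOrder (cs : CoxeterSystem M W) : PartialOrder W where
  le := Relation.ReflTransGen cs.BruhatStep
  le_refl _ := Relation.ReflTransGen.refl
  le_trans _ _ _ := Relation.ReflTransGen.trans
  le_antisymm u w h₁ h₂ := by
    have key : ∀ {x y : W}, Relation.ReflTransGen cs.BruhatStep x y →
        x = y ∨ cs.length x < cs.length y := by
      intro x y h
      induction h with
      | refl => exact Or.inl rfl
      | tail _ hs ih =>
        rcases ih with rfl | ih
        · exact Or.inr hs.2
        · exact Or.inr (ih.trans hs.2)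
    rcases key h₁ with h | h
    · exact h
    · rcases key h₂ with h' | h'
      · exact h'.symm
      · exact absurd h' (lt_asymm h)

/-- The set `S` of simple generators, as a subset of `W`. -/
def generators (cs : CoxeterSystem M W) : Set W := Set.range cs.simple

/-- The set `S \ {a}`, which indexes the principal dihedral subgroups `⟨s, a⟩`. -/
def generatorsNe (cs : CoxeterSystem M W) (a : W) : Set W := {s | s ∈ cs.generators ∧ s ≠ a}

end CoxeterSystem

/-- The underlying set of the subgroup `⟨s, a⟩` generated by `s` and `a`. -/
def dihedral {W : Type*} [Group W] (s a : W) : Set W := (Subgroup.closure {s, a} : Subgroup W)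

theorem one_mem_dihedral {W : Type*} [Group W] (s a : W) : (1 : W) ∈ dihedral s a :=
  (Subgroup.closure {s, a}).one_mem

/-!
# Maximal matchings for the Bruhat order

Let `(W, S)` be a Coxeter system with its Bruhat order. The maximal matchings `φ` of `W` with
`φ 1 = a` correspond to the families of matchings of the dihedral subgroups `⟨s, a⟩`, `s ≠ a`.

A distinguished matching is almost determined recursively. If `φ` moves `u` up, the coatoms of
`φ u` are determined by the values of `φ` below `u`, and an element of `W` is determined by its
coatoms unless it lies in a dihedral standard parabolic subgroup
(`IsBruhatOrder.exists_mem_parabolic_of_coat_eq`). As `a ≤ φ u`, such a dihedral subgroup contains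
`a`. Hence two partial matchings which agree on the subgroups `⟨s, a⟩` agree wherever both are
defined (`IsBruhatOrder.eval_eq_eval_of_agree`), and all partial matchings compatible with given
matchings of the subgroups `⟨s, a⟩` have a common extension, the union, which is the unique maximal
matching restricting to them. The data are themselves compatible because two of these subgroups
meet in `{1, a}`.

Conversely, every partial matching preserves `⟨s, a⟩` (`IsBruhatOrder.eval_mem_parabolic`), since an
element outside a parabolic subgroup has a coatom outside it or is a simple reflection. A maximal
one is defined on all of `⟨s, a⟩` (`IsBruhatOrder.mem_dom_of_isMax`): in a dihedral group any element
lies below every longer one and there are at most two elements of each length, so exactly one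
element of each length moves up, and a matching that stops inside `⟨s, a⟩` can be continued.

The facts needed about the Bruhat order (the lifting property, parabolic subgroups being lower sets)
rest on the strong exchange property, which is obtained from the action of `W` on `W × ZMod 2` that
records the parity of the number of times a reflection occurs in the inversion sequence of a word.
-/

/-! ### The strong exchange property -/

namespace CoxeterSystem

variable {B W : Type*} [Group W] {M : CoxeterMatrix B} (cs : CoxeterSystem M W)

open scoped Classical in
/-- The generator `i` acts on `W × ZMod 2` by conjugation on the first component, and changes the
second component exactly at the simple reflection `i` itself. -/
noncomputable def signedConj (i : B) : Function.End (W × ZMod 2) := fun p =>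
  (cs.simple i * p.1 * cs.simple i, p.2 + if p.1 = cs.simple i then 1 else 0)

open scoped Classical in
theorem signedConj_mul_pow_apply (i j : B) (n : ℕ) (t : W) (ε : ZMod 2) :
    ((cs.signedConj i * cs.signedConj j) ^ n) (t, ε) =
      ((cs.simple i * cs.simple j) ^ n * t * ((cs.simple i * cs.simple j) ^ n)⁻¹,
        ε + ∑ k ∈ Finset.range (2 * n),
          if t = cs.simple j * (cs.simple i * cs.simple j) ^ k then 1 else 0) := by
  induction n with
  | zero => exact Prod.ext (by simp; rfl) (by simp; rfl)
  | succ n ih =>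
    have key : ∀ k : ℕ, ((cs.simple i * cs.simple j) ^ k)⁻¹ * cs.simple j =
        cs.simple j * (cs.simple i * cs.simple j) ^ k := by
      intro k
      induction k with
      | zero => simp
      | succ k ihk =>
        rw [pow_succ, mul_inv_rev, mul_assoc, ihk, ← pow_succ, pow_succ' _ k]
        simp [mul_assoc]
    rw [pow_succ']
    change cs.signedConj i (cs.signedConj j (((cs.signedConj i * cs.signedConj j) ^ n) (t, ε))) = _
    rw [ih]
    set p := cs.simple i * cs.simple j with hp
    have h1 : (p ^ n * t * (p ^ n)⁻¹ = cs.simple j) ↔ t = cs.simple j * p ^ (2 * n) := by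
      rw [mul_inv_eq_iff_eq_mul, ← eq_inv_mul_iff_mul_eq, ← mul_assoc, key, two_mul, pow_add,
        mul_assoc]
    have h2 : (cs.simple j * (p ^ n * t * (p ^ n)⁻¹) * cs.simple j = cs.simple i) ↔
        t = cs.simple j * p ^ (2 * n + 1) := by
      have e : cs.simple j * p ^ (2 * n + 1) =
          (p ^ n)⁻¹ * (cs.simple j * cs.simple i * cs.simple j) * p ^ n := by
        rw [mul_assoc (cs.simple j), ← hp, ← mul_assoc, key, mul_assoc, mul_assoc, ← pow_succ',
          ← pow_add]
        congr 2; ring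
      rw [e]
      generalize p ^ n = q
      constructor
      · intro h
        rw [← h]
        simp [mul_assoc]
      · rintro rfl
        simp [mul_assoc]
    have h3 : 2 * (n + 1) = 2 * n + 1 + 1 := by ring
    rw [h3, Finset.sum_range_succ, Finset.sum_range_succ]
    change (cs.simple i * (cs.simple j * (p ^ n * t * (p ^ n)⁻¹) * cs.simple j) * cs.simple i, _) = _
    refine Prod.ext ?_ ?_
    · simp [pow_succ', mul_assoc, hp]
    · simp only [signedConj, h1, h2]
      simp only [add_assoc]

theorem isLiftable_signedConj : M.IsLiftable cs.signedConj := by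
  classical
  intro i j
  funext ⟨t, ε⟩
  rw [signedConj_mul_pow_apply, two_mul, Finset.sum_range_add]
  simp [pow_add, ← two_mul, CharTwo.two_eq_zero]
  rfl

/-- The action of `W` on `W × ZMod 2` extending `signedConj`. -/
noncomputable def signedAction : W →* Function.End (W × ZMod 2) :=
  cs.lift ⟨cs.signedConj, cs.isLiftable_signedConj⟩

theorem signedAction_simple (i : B) : cs.signedAction (cs.simple i) = cs.signedConj i :=
  cs.lift_apply_simple cs.isLiftable_signedConj i

theorem signedAction_mul_apply (v w : W) (p : W × ZMod 2) :
    cs.signedAction (v * w) p = cs.signedAction v (cs.signedAction w p) := by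
  rw [map_mul]; rfl

open scoped Classical in
/-- The second component of the action counts, modulo two, the occurrences of `t` in the right
inversion sequence of any word. -/
theorem signedAction_wordProd (ω : List B) (t : W) (ε : ZMod 2) :
    cs.signedAction (cs.wordProd ω) (t, ε) =
      (cs.wordProd ω * t * (cs.wordProd ω)⁻¹, ε + ((cs.rightInvSeq ω).count t : ZMod 2)) := by
  induction ω with
  | nil => simp; rfl
  | cons i ω ih =>
    rw [wordProd_cons, signedAction_mul_apply, ih, signedAction_simple]
    have h : (cs.wordProd ω * t * (cs.wordProd ω)⁻¹ = cs.simple i) ↔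
        ((cs.wordProd ω)⁻¹ * cs.simple i * cs.wordProd ω = t) := by
      constructor
      · intro h; rw [← h]; group
      · intro h; rw [← h]; group
    refine Prod.ext ?_ ?_
    · simp [signedConj, mul_assoc]
    · simp only [signedConj, h, rightInvSeq, List.count_cons, beq_iff_eq]
      split_ifs <;> simp [add_assoc]

theorem signedAction_add (w t : W) (ε δ : ZMod 2) :
    cs.signedAction w (t, ε + δ) =
      ((cs.signedAction w (t, ε)).1, (cs.signedAction w (t, ε)).2 + δ) := by
  obtain ⟨ω, rfl⟩ := cs.wordProd_surjective w
  simp only [signedAction_wordProd, Prod.mk.injEq, true_and]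
  ring

theorem signedAction_reflection {t : W} (ht : cs.IsReflection t) :
    cs.signedAction t (t, 0) = (t, 1) := by
  obtain ⟨w, i, rfl⟩ := ht
  set t := w * cs.simple i * w⁻¹ with ht
  obtain ⟨δ, hδ⟩ : ∃ δ, cs.signedAction w⁻¹ (t, 0) = (cs.simple i, δ) := by
    obtain ⟨ω, hω⟩ := cs.wordProd_surjective w⁻¹
    exact ⟨_, by rw [← hω, signedAction_wordProd, hω, ht]; exact Prod.ext (by group) rfl⟩
  have hback : cs.signedAction w (cs.simple i, δ) = (t, 0) := by
    rw [← hδ, ← signedAction_mul_apply, mul_inv_cancel, map_one]; rfl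
  nth_rewrite 1 [ht]
  rw [signedAction_mul_apply, hδ, signedAction_mul_apply, signedAction_simple]
  have : cs.signedConj i (cs.simple i, δ) = (cs.simple i, δ + 1) := by
    simp [signedConj]
  rw [this, signedAction_add, hback]
  simp

/-- The **strong exchange property**, in terms of inversion sequences: a right inversion of the
product of a word, reduced or not, occurs in its right inversion sequence. -/
theorem mem_rightInvSeq_of_isRightInversion {ω : List B} {t : W}
    (h : cs.IsRightInversion (cs.wordProd ω) t) : t ∈ cs.rightInvSeq ω := by
  classical
  obtain ⟨ht, hlt⟩ := h
  by_contra hmem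
  obtain ⟨ν, hν, hw⟩ := cs.exists_isReduced (cs.wordProd ω * t)
  have h1 : cs.signedAction (cs.wordProd ω * t) (t, 0) =
      (cs.wordProd ω * t * (cs.wordProd ω)⁻¹, 1) := by
    rw [signedAction_mul_apply, signedAction_reflection cs ht, signedAction_wordProd,
      List.count_eq_zero_of_not_mem hmem]
    simp
  rw [hw, signedAction_wordProd] at h1
  -- The parity forces `t` to be an inversion of `wordProd ω * t`, so both lengths would drop.
  have hmem' : t ∈ cs.rightInvSeq ν := by
    by_contra hn
    rw [List.count_eq_zero_of_not_mem hn] at h1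
    simpa using congrArg Prod.snd h1
  have h2 := (cs.isRightInversion_of_mem_rightInvSeq hν hmem').2
  rw [← hw, mul_assoc, ht.mul_self, mul_one] at h2
  exact lt_asymm hlt h2

/-- The **strong exchange property**: a right inversion deletes a letter from any word. -/
theorem exists_eraseIdx_of_isRightInversion {ω : List B} {t : W}
    (h : cs.IsRightInversion (cs.wordProd ω) t) :
    ∃ j < ω.length, cs.wordProd ω * t = cs.wordProd (ω.eraseIdx j) := by
  obtain ⟨j, hj, rfl⟩ := List.mem_iff_getElem.1 (cs.mem_rightInvSeq_of_isRightInversion h)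
  refine ⟨j, by simpa using hj, ?_⟩
  rw [← cs.wordProd_mul_getD_rightInvSeq, List.getD_eq_getElem _ _ hj]

end CoxeterSystem

/-! ### Covers and the lifting property of the Bruhat order -/

namespace CoxeterSystem

variable {B W : Type*} [Group W] {M : CoxeterMatrix B} {cs : CoxeterSystem M W}

/-- The given partial order on `W` is the Bruhat order. Keeping it as a hypothesis lets the order
be an ordinary instance argument, although `bruhatOrder` depends on the Coxeter system. -/
def IsBruhatOrder (cs : CoxeterSystem M W) [PartialOrder W] : Prop :=
  ∀ x y : W, x ≤ y ↔ Relation.ReflTransGen cs.BruhatStep x y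

/-- Right multiplication by a simple reflection preserves an elementary step, unless it exchanges
the two ends. -/
theorem BruhatStep.mul_simple {u w : W} (h : cs.BruhatStep u w) (i : B) :
    w = u * cs.simple i ∨ cs.BruhatStep (u * cs.simple i) (w * cs.simple i) := by
  obtain ⟨⟨t, ht, rfl⟩, hlt⟩ := h
  have ht' : cs.IsReflection (cs.simple i * t * cs.simple i) := by
    simpa using ht.conj (cs.simple i)
  have he : u * t * cs.simple i = u * cs.simple i * (cs.simple i * t * cs.simple i) := by
    simp [mul_assoc]
  rcases lt_or_gt_of_ne (ht'.length_mul_left_ne (u * cs.simple i)) with h1 | h1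
  · left
    obtain ⟨ω, hω, rfl⟩ := cs.exists_isReduced u
    have hinv : cs.IsRightInversion (cs.wordProd (ω.concat i))
        (cs.simple i * t * cs.simple i) := ⟨ht', by rwa [wordProd_concat]⟩
    obtain ⟨j, hj, hje⟩ := cs.exists_eraseIdx_of_isRightInversion hinv
    rw [wordProd_concat, ← he, List.concat_eq_append] at hje
    rw [List.length_concat] at hj
    rcases Nat.lt_succ_iff_lt_or_eq.1 hj with hj | rfl
    · rw [List.eraseIdx_append_of_lt_length hj, wordProd_append, wordProd_singleton,
        mul_left_inj] at hje
      have h2 := cs.length_wordProd_le (ω.eraseIdx j)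
      have h3 := List.length_eraseIdx_of_lt hj
      rw [← hje] at h2
      have h4 := hω.eq
      omega
    · rw [List.eraseIdx_append_of_length_le le_rfl] at hje
      simp only [Nat.sub_self, List.eraseIdx_cons_zero, List.append_nil] at hje
      simpa using congrArg (· * cs.simple i) hje
  · exact Or.inr ⟨⟨_, ht', he⟩, by rwa [he]⟩

theorem bruhatStep_mul_simple {w : W} {i : B} (h : cs.IsRightDescent w i) :
    cs.BruhatStep (w * cs.simple i) w :=
  ⟨⟨_, cs.isReflection_simple i, by simp⟩, h⟩

theorem bruhatStep_simple_mul {w : W} {i : B} (h : cs.IsLeftDescent w i) :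
    cs.BruhatStep (cs.simple i * w) w :=
  ⟨⟨w⁻¹ * cs.simple i * w, by simpa using (cs.isReflection_simple i).conj w⁻¹,
    by simp [mul_assoc]⟩, h⟩

/-- A left descent of `w * s i` remains one of `w` when `i` is a right descent of `w`. -/
theorem isLeftDescent_of_isLeftDescent_mul_simple {w : W} {i l : B} (hi : cs.IsRightDescent w i)
    (hl : cs.IsLeftDescent (w * cs.simple i) l) : cs.IsLeftDescent w l := by
  have h1 := cs.isRightDescent_iff.1 hi
  have h2 := cs.isLeftDescent_iff.1 hl
  have h3 := cs.length_mul_le (cs.simple l * (w * cs.simple i)) (cs.simple i)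
  rw [mul_assoc, simple_mul_simple_cancel_right, length_simple] at h3
  rw [IsLeftDescent]
  rcases cs.length_simple_mul w l with h4 | h4 <;> omega

namespace IsBruhatOrder

variable [PartialOrder W] (hb : cs.IsBruhatOrder)
include hb

theorem le_of_step {u w : W} (h : cs.BruhatStep u w) : u ≤ w :=
  (hb u w).2 (.single h)

theorem length_lt {u w : W} (h : u < w) : cs.length u < cs.length w := by
  have key : ∀ {x y : W}, Relation.ReflTransGen cs.BruhatStep x y →
      x = y ∨ cs.length x < cs.length y := by
    intro x y h
    induction h with
    | refl => exact Or.inl rfl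
    | tail _ hs ih =>
      rcases ih with rfl | ih
      · exact Or.inr hs.2
      · exact Or.inr (ih.trans hs.2)
  exact (key ((hb u w).1 h.le)).resolve_left h.ne

theorem covBy_of_length {u w : W} (h : u ≤ w) (hl : cs.length w = cs.length u + 1) : u ⋖ w := by
  refine ⟨lt_of_le_of_ne h (by rintro rfl; omega), fun v h1 h2 => ?_⟩
  have := hb.length_lt h1
  have := hb.length_lt h2
  omega

theorem mul_simple_covBy {w : W} {i : B} (h : cs.IsRightDescent w i) : w * cs.simple i ⋖ w :=
  hb.covBy_of_length (hb.le_of_step (bruhatStep_mul_simple h)) (cs.isRightDescent_iff.1 h).symm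

theorem simple_mul_covBy {w : W} {i : B} (h : cs.IsLeftDescent w i) : cs.simple i * w ⋖ w :=
  hb.covBy_of_length (hb.le_of_step (bruhatStep_simple_mul h)) (cs.isLeftDescent_iff.1 h).symm

theorem one_le (w : W) : 1 ≤ w := by
  induction hn : cs.length w using Nat.strong_induction_on generalizing w with
  | _ n ih =>
    by_cases h : w = 1
    · exact h.ge
    · obtain ⟨i, hi⟩ := cs.exists_rightDescent_of_ne_one h
      exact (ih _ (hn ▸ hi) _ rfl).trans (hb.mul_simple_covBy hi).le

theorem exists_simple_le {w : W} (h : w ≠ 1) : ∃ i, cs.simple i ≤ w := by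
  induction hn : cs.length w using Nat.strong_induction_on generalizing w with
  | _ n ih =>
    obtain ⟨i, hi⟩ := cs.exists_rightDescent_of_ne_one h
    by_cases h' : w * cs.simple i = 1
    · exact ⟨i, by rw [mul_eq_one_iff_eq_inv.1 h', cs.inv_simple]⟩
    · obtain ⟨j, hj⟩ := ih _ (hn ▸ hi) h' rfl
      exact ⟨j, hj.trans (hb.mul_simple_covBy hi).le⟩

theorem one_covBy_iff {w : W} : 1 ⋖ w ↔ w ∈ cs.generators := by
  constructor
  · intro h
    obtain ⟨i, hi⟩ := hb.exists_simple_le h.lt.ne'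
    refine ⟨i, hi.eq_of_not_lt fun hlt => h.2 ?_ hlt⟩
    refine lt_of_le_of_ne (hb.one_le _) fun he => ?_
    have := cs.length_simple i
    rw [← he, cs.length_one] at this
    omega
  · rintro ⟨i, rfl⟩
    exact hb.covBy_of_length (hb.one_le _) (by simp)

/-- Multiplying the smaller element by a right descent of the larger one stays below. -/
theorem mul_simple_le {v y : W} {i : B} (h : v ≤ y) (hi : cs.IsRightDescent y i) :
    v * cs.simple i ≤ y := by
  induction (hb v y).1 h using Relation.ReflTransGen.head_induction_on with
  | refl => exact (hb.mul_simple_covBy hi).le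
  | head hs hr ih =>
    have h' := (hb _ _).2 hr
    rcases hs.mul_simple i with e | hs'
    · rwa [← e]
    · exact (hb.le_of_step hs').trans (ih h')

/-- The lifting property of the Bruhat order. -/
theorem le_mul_simple {v y : W} {i : B} (h : v ≤ y)
    (hv : ¬ cs.IsRightDescent v i) : v ≤ y * cs.simple i := by
  have key : v ≤ y * cs.simple i ∨ v * cs.simple i ≤ y * cs.simple i := by
    clear hv
    induction (hb v y).1 h using Relation.ReflTransGen.head_induction_on with
    | refl => exact Or.inr le_rfl
    | head hs hr ih =>
      rcases ih ((hb _ _).2 hr) with h1 | h1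
      · exact Or.inl ((hb.le_of_step hs).trans h1)
      · rcases hs.mul_simple i with e | hs'
        · rw [e, simple_mul_simple_cancel_right] at h1
          exact Or.inl h1
        · exact Or.inr ((hb.le_of_step hs').trans h1)
  refine key.elim id fun h1 => le_trans (hb.le_of_step ?_) h1
  refine ⟨⟨_, cs.isReflection_simple i, rfl⟩, ?_⟩
  have := cs.not_isRightDescent_iff.1 hv
  omega

theorem eq_mul_simple_of_covBy {v y : W} {i : B} (h : v ⋖ y) (hi : cs.IsRightDescent y i)
    (hv : ¬ cs.IsRightDescent v i) : v = y * cs.simple i :=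
  (hb.le_mul_simple h.le hv).eq_of_not_lt fun hlt => h.2 hlt (hb.mul_simple_covBy hi).lt

end IsBruhatOrder

/-! ### Standard parabolic subgroups -/

/-- The standard parabolic subgroup generated by the simple reflections in `J`. -/
def parabolic (cs : CoxeterSystem M W) (J : Set B) : Subgroup W :=
  Subgroup.closure (cs.simple '' J)

variable {J : Set B}

theorem simple_mem_parabolic {i : B} (h : i ∈ J) : cs.simple i ∈ cs.parabolic J :=
  Subgroup.subset_closure ⟨i, h, rfl⟩

theorem wordProd_mem_parabolic {ω : List B} (h : ∀ i ∈ ω, i ∈ J) :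
    cs.wordProd ω ∈ cs.parabolic J := by
  induction ω with
  | nil => simp [one_mem]
  | cons i ω ih =>
    rw [wordProd_cons]
    exact mul_mem (simple_mem_parabolic (h i (by simp))) (ih fun j hj => h j (by simp [hj]))

/-- Every element of a standard parabolic subgroup has a reduced word with letters in `J`. -/
theorem exists_isReduced_of_mem_parabolic {w : W} (h : w ∈ cs.parabolic J) :
    ∃ ω : List B, cs.IsReduced ω ∧ w = cs.wordProd ω ∧ ∀ i ∈ ω, i ∈ J := by
  have step : ∀ (x : W) (i : B), i ∈ J →
      (∃ ω : List B, cs.IsReduced ω ∧ x = cs.wordProd ω ∧ ∀ i ∈ ω, i ∈ J) →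
      ∃ ω : List B, cs.IsReduced ω ∧ x * cs.simple i = cs.wordProd ω ∧ ∀ i ∈ ω, i ∈ J := by
    rintro _ i hi ⟨ω, hω, rfl, hJ⟩
    by_cases hd : cs.IsRightDescent (cs.wordProd ω) i
    · obtain ⟨j, hj, he⟩ := cs.exists_eraseIdx_of_isRightInversion
        ((cs.isRightInversion_simple_iff_isRightDescent _ i).2 hd)
      refine ⟨ω.eraseIdx j, ?_, he, fun k hk => hJ k (List.mem_of_mem_eraseIdx hk)⟩
      have h1 := cs.isRightDescent_iff.1 hd
      have h2 := List.length_eraseIdx_of_lt hj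
      have h3 := hω.eq
      rw [IsReduced, ← he]
      omega
    · refine ⟨ω.concat i, ?_, (cs.wordProd_concat i ω).symm, fun k hk => ?_⟩
      · rw [IsReduced, wordProd_concat, cs.not_isRightDescent_iff.1 hd, hω.eq, List.length_concat]
      · rcases (by simpa using hk : k ∈ ω ∨ k = i) with hk | rfl
        exacts [hJ k hk, hi]
  induction h using Subgroup.closure_induction_right with
  | one => exact ⟨[], by simp [IsReduced], by simp, by simp⟩
  | mul_right x y hx hy ih =>
    obtain ⟨i, hi, rfl⟩ := hy
    exact step x i hi ih
  | mul_inv_cancel x y hx hy ih =>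
    obtain ⟨i, hi, rfl⟩ := hy
    rw [inv_simple]
    exact step x i hi ih

theorem BruhatStep.mem_parabolic {u w : W} (h : cs.BruhatStep u w) (hw : w ∈ cs.parabolic J) :
    u ∈ cs.parabolic J := by
  obtain ⟨⟨t, ht, rfl⟩, hlt⟩ := h
  obtain ⟨ω, -, he, hJ⟩ := exists_isReduced_of_mem_parabolic hw
  have e : u = u * t * t := by rw [mul_assoc, ht.mul_self, mul_one]
  obtain ⟨j, -, hj⟩ := cs.exists_eraseIdx_of_isRightInversion (ω := ω) (t := t)
    ⟨ht, by rwa [← he, ← e]⟩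
  rw [← he, ← e] at hj
  rw [hj]
  exact wordProd_mem_parabolic fun k hk => hJ k (List.mem_of_mem_eraseIdx hk)

theorem IsBruhatOrder.isLowerSet_parabolic [PartialOrder W] (hb : cs.IsBruhatOrder) :
    IsLowerSet (cs.parabolic J : Set W) := by
  intro w u h hw
  induction (hb u w).1 h using Relation.ReflTransGen.head_induction_on with
  | refl => exact hw
  | head hs hr ih => exact hs.mem_parabolic (ih ((hb _ _).2 hr))

theorem simple_mem_parabolic_iff {i : B} :
    cs.simple i ∈ cs.parabolic J ↔ ∃ j ∈ J, cs.simple i = cs.simple j := by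
  constructor
  · intro h
    obtain ⟨ω, hω, he, hJ⟩ := exists_isReduced_of_mem_parabolic h
    have h1 := hω.eq
    rw [← he, length_simple] at h1
    obtain ⟨j, rfl⟩ := List.length_eq_one_iff.1 h1.symm
    exact ⟨j, hJ j (by simp), by simpa using he⟩
  · rintro ⟨j, hj, e⟩
    rw [e]
    exact simple_mem_parabolic hj

theorem mem_parabolic_of_isLeftDescent {w : W} {i : B} (hw : w ∈ cs.parabolic J)
    (hi : cs.IsLeftDescent w i) : cs.simple i ∈ cs.parabolic J := by
  have h := (bruhatStep_simple_mul hi).mem_parabolic hw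
  simpa using mul_mem h (inv_mem hw)

theorem mem_parabolic_of_isRightDescent {w : W} {i : B} (hw : w ∈ cs.parabolic J)
    (hi : cs.IsRightDescent w i) : cs.simple i ∈ cs.parabolic J := by
  have h := (bruhatStep_mul_simple hi).mem_parabolic hw
  simpa using mul_mem (inv_mem hw) h

/-- If `p` has minimal length in its coset `p W_J`, lengths add up in `p * w` for `w ∈ W_J`. -/
theorem length_mul_of_minimal {p : W}
    (hp : ∀ w ∈ cs.parabolic J, cs.length p ≤ cs.length (p * w)) {w : W}
    (hw : w ∈ cs.parabolic J) : cs.length (p * w) = cs.length p + cs.length w := by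
  obtain ⟨ω, hω, rfl, hJ⟩ := exists_isReduced_of_mem_parabolic hw
  clear hw
  induction ω using List.reverseRecOn with
  | nil => simp
  | append_singleton ω i ih =>
    have hω' : cs.IsReduced ω := by simpa using hω.take ω.length
    have hJ' : ∀ k ∈ ω, k ∈ J := fun k hk => hJ k (by simp [hk])
    have hi : i ∈ J := hJ i (by simp)
    have ih := ih hω' hJ'
    have hl := hω.eq
    rw [hω.eq]
    rw [wordProd_append, wordProd_singleton] at hl ⊢
    rw [← mul_assoc]
    rw [hω'.eq] at ih
    rw [List.length_append, List.length_singleton] at hl ⊢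
    rcases cs.length_mul_simple (p * cs.wordProd ω) i with h | h
    · omega
    · exfalso
      -- By exchange, the last letter would cancel against a letter of `p` or of `ω`.
      obtain ⟨ν, hν, rfl⟩ := cs.exists_isReduced p
      rw [← wordProd_append] at h ih
      obtain ⟨j, hj, he⟩ := cs.exists_eraseIdx_of_isRightInversion
        ((cs.isRightInversion_simple_iff_isRightDescent (cs.wordProd (ν ++ ω)) i).2
          (by rw [IsRightDescent]; omega))
      rw [List.length_append] at hj
      rcases lt_or_ge j ν.length with hj' | hj'
      · rw [List.eraseIdx_append_of_lt_length hj'] at he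
        simp only [wordProd_append] at he
        have hle := hp (cs.wordProd ω * cs.simple i * (cs.wordProd ω)⁻¹)
          (mul_mem (mul_mem (wordProd_mem_parabolic hJ') (simple_mem_parabolic hi))
            (inv_mem (wordProd_mem_parabolic hJ')))
        have e : cs.wordProd ν * (cs.wordProd ω * cs.simple i * (cs.wordProd ω)⁻¹) =
            cs.wordProd (ν.eraseIdx j) := by
          rw [← mul_assoc, ← mul_assoc, he, mul_inv_cancel_right]
        rw [e] at hle
        have h2 := cs.length_wordProd_le (ν.eraseIdx j)
        have h3 := List.length_eraseIdx_of_lt hj'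
        have h4 := hν.eq
        omega
      · rw [List.eraseIdx_append_of_length_le hj'] at he
        simp only [wordProd_append, mul_assoc, mul_right_inj] at he
        have h2 := cs.length_wordProd_le (ω.eraseIdx (j - ν.length))
        have h3 := List.length_eraseIdx_of_lt (l := ω) (i := j - ν.length) (by omega)
        rw [← he] at h2
        omega

theorem exists_minimal_mul (J : Set B) (x : W) : ∃ p u : W, x = p * u ∧ u ∈ cs.parabolic J ∧
    ∀ w ∈ cs.parabolic J, cs.length p ≤ cs.length (p * w) := by
  obtain ⟨v, hv, hmin⟩ := WellFounded.has_min
    (measure fun v => cs.length (x * v)).wf (cs.parabolic J : Set W) ⟨1, one_mem _⟩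
  refine ⟨x * v, v⁻¹, by simp, inv_mem hv, fun w hw => ?_⟩
  rw [mul_assoc]
  exact not_lt.1 (hmin (v * w) (mul_mem hv hw))

end CoxeterSystem

/-! ### Elements with the same coatoms -/

namespace CoxeterSystem

variable {B W : Type*} [Group W] {M : CoxeterMatrix B} {cs : CoxeterSystem M W}

/-- A left descent of the shortest representative of the coset `x W_J` is a left descent of `x`, since
lengths add up in `x = p * u`. -/
theorem exists_common_isLeftDescent_of_minimal {J : Set B} {x p u : W} (hx : x = p * u)
    (hu : u ∈ cs.parabolic J)
    (hp : ∀ w ∈ cs.parabolic J, cs.length p ≤ cs.length (p * w)) (hne : p ≠ 1) :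
    ∃ l, cs.IsLeftDescent x l ∧ cs.IsLeftDescent p l := by
  obtain ⟨l, hl⟩ := cs.exists_leftDescent_of_ne_one hne
  refine ⟨l, ?_, hl⟩
  have h1 := length_mul_of_minimal hp hu
  have h2 := cs.length_mul_le (cs.simple l * p) u
  rw [IsLeftDescent] at hl ⊢
  rw [hx, ← mul_assoc]
  omega

namespace IsBruhatOrder

variable [PartialOrder W] (hb : cs.IsBruhatOrder)
include hb

/-- Distinct elements with the same coatoms have no common right descent: if `i` were one, the
coatom `x * s i` would lie below `y`, hence so would `x` itself, and conversely. -/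
theorem not_isRightDescent_of_coat_eq {x y : W} (h : coat x = coat y) (hne : x ≠ y) {i : B}
    (hx : cs.IsRightDescent x i) : ¬ cs.IsRightDescent y i := by
  intro hy
  have h1 : x * cs.simple i ∈ coat y := h ▸ hb.mul_simple_covBy hx
  have h2 : y * cs.simple i ∈ coat x := h ▸ hb.mul_simple_covBy hy
  have h3 := hb.mul_simple_le h1.le hy
  have h4 := hb.mul_simple_le h2.le hx
  rw [simple_mul_simple_cancel_right] at h3 h4
  exact hne (le_antisymm h3 h4)

/-- If `x` and `y` have the same coatoms and `r` is a right descent of `y` only, then removing any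
left descent from `x` gives the coatom `y * s r`: the coatom `s l * x` of `y` does not have `r` as
a descent, and `y * s r` is the only such coatom of `y`. -/
theorem simple_mul_eq_mul_simple_of_coat_eq {x y : W} (h : coat x = coat y) {r l : B}
    (hy : cs.IsRightDescent y r) (hx : ¬ cs.IsRightDescent x r) (hl : cs.IsLeftDescent x l) :
    cs.simple l * x = y * cs.simple r := by
  have h1 : cs.simple l * x ∈ coat y := h ▸ hb.simple_mul_covBy hl
  refine hb.eq_mul_simple_of_covBy h1 hy fun hd => ?_
  have h2 := cs.not_isRightDescent_iff.1 hx
  have h3 := cs.isRightDescent_iff.1 hd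
  have h4 := cs.isLeftDescent_iff.1 hl
  rw [mul_assoc] at h3
  rcases cs.length_simple_mul (x * cs.simple r) l with h5 | h5 <;> omega

/-- Distinct elements with the same coatoms lie in a common dihedral standard parabolic subgroup.

Let `s`, `r` be right descents of `x` and `y`, and let `p`, `q` be the shortest elements of the
cosets of `x` and `y` modulo `W_{r,s}`. If `p ≠ 1`, a left descent `l` of `p` is one of `x`, so
`s l * x = y * s r` shows that `q` is shorter than `p`. By symmetry `p` or `q` is `1`, and then both
elements lie in `W_{r,s}`. -/
theorem exists_mem_parabolic_of_coat_eq {x y : W} (h : coat x = coat y) (hne : x ≠ y) :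
    ∃ r s : B, cs.simple r ≠ cs.simple s ∧
      x ∈ cs.parabolic {r, s} ∧ y ∈ cs.parabolic {r, s} := by
  have hone : ∀ {z w : W}, coat z = coat w → z ≠ w → z ≠ 1 := by
    rintro z w hzw hne rfl
    obtain ⟨i, hi⟩ := cs.exists_rightDescent_of_ne_one hne.symm
    have h1 : w * cs.simple i ∈ coat 1 := hzw ▸ hb.mul_simple_covBy hi
    exact absurd h1.lt (hb.one_le _).not_gt
  have hx1 := hone h hne
  have hy1 := hone h.symm hne.symm
  obtain ⟨s, hs⟩ := cs.exists_rightDescent_of_ne_one hx1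
  obtain ⟨r, hr⟩ := cs.exists_rightDescent_of_ne_one hy1
  have hsy := hb.not_isRightDescent_of_coat_eq h hne hs
  have hrx := hb.not_isRightDescent_of_coat_eq h.symm hne.symm hr
  have hlx := fun l => hb.simple_mul_eq_mul_simple_of_coat_eq (l := l) h hr hrx
  have hly := fun l => hb.simple_mul_eq_mul_simple_of_coat_eq (l := l) h.symm hs hsy
  refine ⟨r, s, fun e => hsy (by rwa [IsRightDescent, ← e]), ?_⟩
  have hrJ : cs.simple r ∈ cs.parabolic {r, s} := simple_mem_parabolic (by simp)
  have hsJ : cs.simple s ∈ cs.parabolic {r, s} := simple_mem_parabolic (by simp)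
  -- If one of the two elements lies in the parabolic subgroup, so does the other.
  have hmem : ∀ {z w : W} {i : B}, cs.simple i ∈ cs.parabolic {r, s} → z ≠ 1 →
      (∀ l, cs.IsLeftDescent z l → cs.simple l * z = w * cs.simple i) →
      z ∈ cs.parabolic {r, s} → w ∈ cs.parabolic {r, s} := by
    intro z w i hi hz hl hzJ
    obtain ⟨l, hd⟩ := cs.exists_leftDescent_of_ne_one hz
    have h1 := mul_mem (mul_mem (mem_parabolic_of_isLeftDescent hzJ hd) hzJ) hi
    rwa [hl l hd, simple_mul_simple_cancel_right] at h1
  -- The shortest coset representative drops when passing from one element to the other.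
  have hlt : ∀ {z w p q u v : W} {i : B}, cs.simple i ∈ cs.parabolic {r, s} →
      (∀ l, cs.IsLeftDescent z l → cs.simple l * z = w * cs.simple i) →
      z = p * u → u ∈ cs.parabolic {r, s} →
      (∀ t ∈ cs.parabolic {r, s}, cs.length p ≤ cs.length (p * t)) →
      w = q * v → v ∈ cs.parabolic {r, s} →
      (∀ t ∈ cs.parabolic {r, s}, cs.length q ≤ cs.length (q * t)) →
      p ≠ 1 → cs.length q < cs.length p := by
    intro z w p q u v i hi hl hz hu hp hw hv hq hp1
    obtain ⟨l, hd, hdp⟩ := exists_common_isLeftDescent_of_minimal hz hu hp hp1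
    have h1 := hq (v * cs.simple i * u⁻¹) (mul_mem (mul_mem hv hi) (inv_mem hu))
    have h2 : q * (v * cs.simple i * u⁻¹) = cs.simple l * p := by
      rw [← mul_assoc, ← mul_assoc, ← hw, ← hl l hd, hz]
      group
    rw [h2] at h1
    exact h1.trans_lt hdp
  obtain ⟨p, u, hpu, hu, hp⟩ := exists_minimal_mul (cs := cs) {r, s} x
  obtain ⟨q, v, hqv, hv, hq⟩ := exists_minimal_mul (cs := cs) {r, s} y
  by_cases hp1 : p = 1
  · have hxJ : x ∈ cs.parabolic {r, s} := by rw [hpu, hp1, one_mul]; exact hu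
    exact ⟨hxJ, hmem hrJ hx1 hlx hxJ⟩
  by_cases hq1 : q = 1
  · have hyJ : y ∈ cs.parabolic {r, s} := by rw [hqv, hq1, one_mul]; exact hv
    exact ⟨hmem hsJ hy1 hly hyJ, hyJ⟩
  exact absurd (hlt hrJ hlx hpu hu hp hqv hv hq hp1)
    (hlt hsJ hly hqv hv hq hpu hu hp hq1).not_gt

end IsBruhatOrder

end CoxeterSystem

/-! ### The Bruhat order on dihedral standard parabolic subgroups -/

namespace CoxeterSystem

variable {B W : Type*} [Group W] {M : CoxeterMatrix B} {cs : CoxeterSystem M W} {r s : B}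

theorem exists_isRightDescent_of_mem_parabolic_pair {x : W} (hx : x ∈ cs.parabolic {r, s})
    (hne : x ≠ 1) : cs.IsRightDescent x r ∨ cs.IsRightDescent x s := by
  obtain ⟨i, hi⟩ := cs.exists_rightDescent_of_ne_one hne
  obtain ⟨j, hj, e⟩ := simple_mem_parabolic_iff.1 (mem_parabolic_of_isRightDescent hx hi)
  rw [IsRightDescent, e] at hi
  rcases hj with rfl | rfl
  exacts [Or.inl hi, Or.inr hi]

/-- An element of a dihedral parabolic subgroup is determined by its length and one right descent,
because its reduced words alternate. -/
theorem eq_of_isRightDescent_of_mem_parabolic_pair {x y : W} (hx : x ∈ cs.parabolic {r, s})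
    (hy : y ∈ cs.parabolic {r, s}) (hl : cs.length x = cs.length y) {i : B}
    (hi : i ∈ ({r, s} : Set B)) (hxi : cs.IsRightDescent x i) (hyi : cs.IsRightDescent y i) :
    x = y := by
  induction hn : cs.length x generalizing x y i with
  | zero =>
    exact (cs.length_eq_zero_iff.1 hn).trans
      (cs.length_eq_zero_iff.1 (hl.symm.trans hn)).symm
  | succ n ih =>
    have h1 := cs.isRightDescent_iff.1 hxi
    have h2 := cs.isRightDescent_iff.1 hyi
    have hx' := mul_mem hx (simple_mem_parabolic (cs := cs) hi)
    have hy' := mul_mem hy (simple_mem_parabolic (cs := cs) hi)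
    have hxi' := cs.isRightDescent_iff_not_isRightDescent_mul.1 hxi
    have hyi' := cs.isRightDescent_iff_not_isRightDescent_mul.1 hyi
    refine mul_right_cancel (b := cs.simple i) ?_
    by_cases hx1 : x * cs.simple i = 1
    · rw [hx1, cs.length_one] at h1
      rw [hx1, eq_comm, ← cs.length_eq_zero_iff]
      omega
    · have hy1 : y * cs.simple i ≠ 1 := by
        intro hy1
        rw [hy1, cs.length_one] at h2
        exact hx1 (cs.length_eq_zero_iff.1 (by omega))
      have hj : ∃ j ∈ ({r, s} : Set B), cs.IsRightDescent (x * cs.simple i) j ∧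
          cs.IsRightDescent (y * cs.simple i) j := by
        have h3 := exists_isRightDescent_of_mem_parabolic_pair hx' hx1
        have h4 := exists_isRightDescent_of_mem_parabolic_pair hy' hy1
        rcases hi with rfl | rfl
        · exact ⟨s, by simp, h3.resolve_left hxi', h4.resolve_left hyi'⟩
        · exact ⟨r, by simp, h3.resolve_right hxi', h4.resolve_right hyi'⟩
      obtain ⟨j, hj, hxj, hyj⟩ := hj
      exact ih hx' hy' (by omega) hj hxj hyj (by omega)

/-- A dihedral parabolic subgroup has at most two elements of each length. -/
theorem eq_or_eq_of_mem_parabolic_pair {x y z : W} (hx : x ∈ cs.parabolic {r, s})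
    (hy : y ∈ cs.parabolic {r, s}) (hz : z ∈ cs.parabolic {r, s}) (hxy : x ≠ y)
    (hlx : cs.length z = cs.length x) (hly : cs.length z = cs.length y) : z = x ∨ z = y := by
  by_cases hz1 : z = 1
  · rw [hz1, cs.length_one] at hlx
    rw [hz1, cs.length_eq_zero_iff.1 hlx.symm]
    exact Or.inl rfl
  have hne : ∀ {w : W}, cs.length z = cs.length w → w ≠ 1 := by
    rintro _ h rfl
    rw [cs.length_one] at h
    exact hz1 (cs.length_eq_zero_iff.1 h)
  have hzx : ∀ i ∈ ({r, s} : Set B), cs.IsRightDescent z i → cs.IsRightDescent x i → z = x :=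
    fun i => eq_of_isRightDescent_of_mem_parabolic_pair hz hx hlx
  have hzy : ∀ i ∈ ({r, s} : Set B), cs.IsRightDescent z i → cs.IsRightDescent y i → z = y :=
    fun i => eq_of_isRightDescent_of_mem_parabolic_pair hz hy hly
  have hxy' : ∀ i ∈ ({r, s} : Set B), cs.IsRightDescent x i → cs.IsRightDescent y i → x = y :=
    fun i => eq_of_isRightDescent_of_mem_parabolic_pair hx hy (hlx.symm.trans hly)
  rcases exists_isRightDescent_of_mem_parabolic_pair hz hz1 with h | h <;>
  rcases exists_isRightDescent_of_mem_parabolic_pair hx (hne hlx) with h' | h' <;>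
  rcases exists_isRightDescent_of_mem_parabolic_pair hy (hne hly) with h'' | h'' <;>
  first
  | exact Or.inl (hzx r (by simp) h h')
  | exact Or.inl (hzx s (by simp) h h')
  | exact Or.inr (hzy r (by simp) h h'')
  | exact Or.inr (hzy s (by simp) h h'')
  | exact absurd (hxy' r (by simp) h' h'') hxy
  | exact absurd (hxy' s (by simp) h' h'') hxy

/-- Above two elements of the same length in a dihedral parabolic subgroup there is a longer one. -/
theorem exists_length_succ_of_mem_parabolic_pair {x y : W} (hx : x ∈ cs.parabolic {r, s})
    (hy : y ∈ cs.parabolic {r, s}) (hxy : x ≠ y) (hl : cs.length x = cs.length y) :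
    ∃ z ∈ cs.parabolic {r, s}, cs.length z = cs.length y + 1 := by
  have hx1 : x ≠ 1 := by
    rintro rfl
    rw [cs.length_one] at hl
    exact hxy (cs.length_eq_zero_iff.1 hl.symm).symm
  obtain ⟨i, hi, hxi⟩ : ∃ i ∈ ({r, s} : Set B), cs.IsRightDescent x i := by
    rcases exists_isRightDescent_of_mem_parabolic_pair hx hx1 with h | h
    exacts [⟨r, by simp, h⟩, ⟨s, by simp, h⟩]
  refine ⟨y * cs.simple i, mul_mem hy (simple_mem_parabolic hi), cs.not_isRightDescent_iff.1 ?_⟩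
  exact fun hyi => hxy (eq_of_isRightDescent_of_mem_parabolic_pair hx hy hl hi hxi hyi)

namespace IsBruhatOrder

variable [PartialOrder W] (hb : cs.IsBruhatOrder)
include hb

/-- An element of length one less is obtained by removing the first or the last letter. -/
theorem le_of_length_succ_of_mem_parabolic_pair {x z : W} (hx : x ∈ cs.parabolic {r, s})
    (hz : z ∈ cs.parabolic {r, s}) (hl : cs.length z = cs.length x + 1) : x ≤ z := by
  by_cases hx1 : x = 1
  · rw [hx1]; exact hb.one_le z
  have hz1 : z ≠ 1 := by rintro rfl; simp at hl
  obtain ⟨i, hi, hzi⟩ : ∃ i ∈ ({r, s} : Set B), cs.IsRightDescent z i := by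
    rcases exists_isRightDescent_of_mem_parabolic_pair hz hz1 with h | h
    exacts [⟨r, by simp, h⟩, ⟨s, by simp, h⟩]
  have h1 := cs.isRightDescent_iff.1 hzi
  have hzi1 : z * cs.simple i ≠ 1 := by
    intro h
    rw [h, cs.length_one] at h1
    exact hx1 (cs.length_eq_zero_iff.1 (by omega))
  have hz' := mul_mem hz (simple_mem_parabolic (cs := cs) hi)
  by_cases hxi : cs.IsRightDescent x i
  · obtain ⟨l, hl'⟩ := cs.exists_leftDescent_of_ne_one hzi1
    have h2 := cs.isLeftDescent_iff.1 hl'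
    have h3 := isLeftDescent_of_isLeftDescent_mul_simple hzi hl'
    have h4 := cs.isLeftDescent_iff.1 h3
    have h5 : x = cs.simple l * z :=
      eq_of_isRightDescent_of_mem_parabolic_pair hx
        (mul_mem (mem_parabolic_of_isLeftDescent hz h3) hz) (by omega) hi hxi
        (by rw [IsRightDescent, mul_assoc]; omega)
    rw [h5]
    exact (hb.simple_mul_covBy h3).le
  · have h2 := cs.isRightDescent_iff_not_isRightDescent_mul.1 hzi
    have hj : ∃ j ∈ ({r, s} : Set B), cs.IsRightDescent x j ∧
        cs.IsRightDescent (z * cs.simple i) j := by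
      have h3 := exists_isRightDescent_of_mem_parabolic_pair hx hx1
      have h4 := exists_isRightDescent_of_mem_parabolic_pair hz' hzi1
      rcases hi with rfl | rfl
      · exact ⟨s, by simp, h3.resolve_left hxi, h4.resolve_left h2⟩
      · exact ⟨r, by simp, h3.resolve_right hxi, h4.resolve_right h2⟩
    obtain ⟨j, hj, hxj, hzj⟩ := hj
    rw [eq_of_isRightDescent_of_mem_parabolic_pair hx hz' (by omega) hj hxj hzj]
    exact (hb.mul_simple_covBy hzi).le

theorem lt_of_length_lt_of_mem_parabolic_pair {x z : W} (hx : x ∈ cs.parabolic {r, s})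
    (hz : z ∈ cs.parabolic {r, s}) (hl : cs.length x < cs.length z) : x < z := by
  induction hn : cs.length z generalizing z with
  | zero => omega
  | succ n ih =>
    rcases (by omega : cs.length z = cs.length x + 1 ∨ cs.length x < n) with h | h
    · exact (hb.covBy_of_length (hb.le_of_length_succ_of_mem_parabolic_pair hx hz h) h).lt
    · have hz1 : z ≠ 1 := by rintro rfl; simp at hl
      obtain ⟨i, hi⟩ := cs.exists_rightDescent_of_ne_one hz1
      have h1 := cs.isRightDescent_iff.1 hi
      exact (ih (mul_mem hz (mem_parabolic_of_isRightDescent hz hi)) (by omega)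
        (by omega)).trans (hb.mul_simple_covBy hi).lt

theorem covBy_iff_length_of_mem_parabolic_pair {x z : W} (hx : x ∈ cs.parabolic {r, s})
    (hz : z ∈ cs.parabolic {r, s}) : x ⋖ z ↔ cs.length z = cs.length x + 1 := by
  refine ⟨fun h => ?_, fun h =>
    hb.covBy_of_length (hb.le_of_length_succ_of_mem_parabolic_pair hx hz h) h⟩
  have h0 := hb.length_lt h.lt
  by_contra hne
  have hz1 : z ≠ 1 := by rintro rfl; simp at h0
  obtain ⟨i, hi⟩ := cs.exists_rightDescent_of_ne_one hz1
  have h1 := cs.isRightDescent_iff.1 hi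
  exact h.2 (hb.lt_of_length_lt_of_mem_parabolic_pair hx
    (mul_mem hz (mem_parabolic_of_isRightDescent hz hi)) (by omega)) (hb.mul_simple_covBy hi).lt

end IsBruhatOrder

end CoxeterSystem

/-! ### Matchings of lower sets -/

/-- The total function `g` induces a distinguished matching of the subset `Q` of `P`, where covers
are taken in `P`; for a lower set `Q` these are the covers in `Q`. -/
structure IsMatchingOn {P : Type*} [PartialOrder P] (Q : Set P) (g : P → P) : Prop where
  mapsTo : ∀ u ∈ Q, g u ∈ Q
  involutive : ∀ u ∈ Q, g (g u) = u
  covBy_or_covBy : ∀ u ∈ Q, u ⋖ g u ∨ g u ⋖ u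
  coat_eq : ∀ u ∈ Q, u ⋖ g u → coat (g u) = {u} ∪ {x | ∃ v, v ⋖ u ∧ v ⋖ g v ∧ x = g v}

section Poset

variable {P : Type*} [PartialOrder P]

theorem IsLowerSet.coe_covBy_coe {Q : Set P} (hQ : IsLowerSet Q) {x y : Q} :
    (x : P) ⋖ y ↔ x ⋖ y := by
  refine ⟨fun h => ⟨h.lt, fun z h1 h2 => h.2 h1 h2⟩, fun h => ⟨h.lt, fun z h1 h2 => ?_⟩⟩
  exact h.2 (c := ⟨z, hQ h2.le y.2⟩) h1 h2

theorem isDistinguishedMatching_iff_isMatchingOn {Q : Set P} (hQ : IsLowerSet Q) {f : Q → Q}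
    {g : P → P} (hfg : ∀ x : Q, g x = f x) : IsDistinguishedMatching f ↔ IsMatchingOn Q g := by
  have hcov : ∀ x : Q, ((x : P) ⋖ g x ↔ x ⋖ f x) := fun x => by
    rw [hfg, hQ.coe_covBy_coe]
  constructor
  · intro h
    refine ⟨fun u hu => ?_, fun u hu => ?_, fun u hu => ?_, fun u hu hug => ?_⟩
    · rw [hfg ⟨u, hu⟩]; exact (f ⟨u, hu⟩).2
    · rw [hfg ⟨u, hu⟩, hfg, h.involutive]
    · rcases h.covBy_or_covBy ⟨u, hu⟩ with h1 | h1
      · exact Or.inl ((hcov ⟨u, hu⟩).2 h1)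
      · exact Or.inr (by rw [hfg ⟨u, hu⟩]; exact hQ.coe_covBy_coe.2 h1)
    · have h1 := h.coat_eq ⟨u, hu⟩ ((hcov ⟨u, hu⟩).1 hug)
      rw [hfg ⟨u, hu⟩]
      ext x
      constructor
      · intro hx
        have hx' : (⟨x, hQ hx.le (f ⟨u, hu⟩).2⟩ : Q) ∈ coat (f ⟨u, hu⟩) :=
          hQ.coe_covBy_coe.1 hx
        rw [h1] at hx'
        rcases hx' with hx' | ⟨v, hvu, hv, hx'⟩
        · exact Or.inl (congrArg Subtype.val hx')
        · exact Or.inr ⟨v, hQ.coe_covBy_coe.2 hvu, (hcov v).2 hv, by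
            rw [hfg]; exact congrArg Subtype.val hx'⟩
      · intro hx
        suffices ∃ x' : Q, (x' : P) = x ∧ x' ∈ coat (f ⟨u, hu⟩) by
          obtain ⟨x', rfl, hx'⟩ := this
          exact hQ.coe_covBy_coe.2 hx'
        rw [h1]
        rcases hx with rfl | ⟨v, hvu, hv, rfl⟩
        · exact ⟨⟨x, hu⟩, rfl, Or.inl rfl⟩
        · have hvQ : v ∈ Q := hQ hvu.le hu
          exact ⟨f ⟨v, hvQ⟩, (hfg ⟨v, hvQ⟩).symm, Or.inr ⟨⟨v, hvQ⟩, hQ.coe_covBy_coe.1 hvu,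
            (hcov ⟨v, hvQ⟩).1 hv, rfl⟩⟩
  · intro h
    refine ⟨fun u => ?_, fun u => ?_, fun u hu => ?_⟩
    · refine Subtype.ext ?_
      rw [← hfg, ← hfg, h.involutive u u.2]
    · rcases h.covBy_or_covBy u u.2 with h1 | h1
      · exact Or.inl ((hcov u).1 h1)
      · exact Or.inr (by rw [hfg] at h1; exact hQ.coe_covBy_coe.1 h1)
    · have h1 := h.coat_eq u u.2 ((hcov u).2 hu)
      ext x
      have hx : x ∈ coat (f u) ↔ (x : P) ∈ coat (g u) := by
        rw [hfg]; exact hQ.coe_covBy_coe.symm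
      rw [hx, h1]
      constructor
      · rintro (hx | ⟨v, hvu, hv, hx⟩)
        · exact Or.inl (Subtype.ext hx)
        · have hvQ : v ∈ Q := hQ hvu.le u.2
          exact Or.inr ⟨⟨v, hvQ⟩, hQ.coe_covBy_coe.1 hvu, (hcov ⟨v, hvQ⟩).1 hv,
            Subtype.ext (hx.trans (hfg ⟨v, hvQ⟩))⟩
      · rintro (rfl | ⟨v, hvu, hv, rfl⟩)
        · exact Or.inl rfl
        · exact Or.inr ⟨v, hQ.coe_covBy_coe.2 hvu, (hcov v).2 hv, (hfg v).symm⟩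

namespace PartialMatching

open scoped Classical in
/-- The underlying total function of a partial matching, equal to the identity outside `dom`. -/
noncomputable def eval (φ : PartialMatching P) (x : P) : P :=
  if h : x ∈ φ.dom then φ.toFun ⟨x, h⟩ else x

variable {φ ψ : PartialMatching P}

theorem eval_coe (φ : PartialMatching P) (x : φ.dom) : φ.eval x = φ.toFun x :=
  dif_pos x.2

theorem isMatchingOn (φ : PartialMatching P) : IsMatchingOn (φ.dom : Set P) φ.eval :=
  (isDistinguishedMatching_iff_isMatchingOn φ.dom.lower φ.eval_coe).1 φ.isMatching

theorem maps_iff {x y : P} : φ.Maps x y ↔ x ∈ φ.dom ∧ φ.eval x = y := by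
  constructor
  · rintro ⟨h, rfl⟩
    exact ⟨h, φ.eval_coe ⟨x, h⟩⟩
  · rintro ⟨h, rfl⟩
    exact ⟨h, (φ.eval_coe ⟨x, h⟩).symm⟩

theorem le_iff : φ ≤ ψ ↔ ∀ x ∈ φ.dom, x ∈ ψ.dom ∧ ψ.eval x = φ.eval x := by
  constructor
  · intro h x hx
    have := maps_iff.1 (h ⟨x, hx⟩)
    rwa [← eval_coe] at this
  · intro h x
    exact maps_iff.2 (by rw [← eval_coe]; exact h x x.2)

/-- The partial matching induced by a total function on a lower set. -/
def ofMatchingOn (Q : LowerSet P) (g : P → P) (h : IsMatchingOn (Q : Set P) g) :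
    PartialMatching P where
  dom := Q
  toFun x := ⟨g x, h.mapsTo x x.2⟩
  isMatching := (isDistinguishedMatching_iff_isMatchingOn Q.lower fun _ => rfl).2 h

theorem eval_ofMatchingOn {Q : LowerSet P} {g : P → P} (h : IsMatchingOn (Q : Set P) g) {x : P}
    (hx : x ∈ Q) : (ofMatchingOn Q g h).eval x = g x :=
  (ofMatchingOn Q g h).eval_coe ⟨x, hx⟩

theorem eval_eq_eval_of_le (h : φ ≤ ψ) {x : P} (hx : x ∈ φ.dom) : ψ.eval x = φ.eval x :=
  (le_iff.1 h x hx).2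

theorem dom_subset_of_le (h : φ ≤ ψ) {x : P} (hx : x ∈ φ.dom) : x ∈ ψ.dom :=
  (le_iff.1 h x hx).1

/-- A family of partial matchings, any two of which agree where both are defined, has a common
extension whose domain is the union of the domains. -/
theorem exists_union (F : Set (PartialMatching P))
    (hF : ∀ φ ∈ F, ∀ ψ ∈ F, ∀ x ∈ φ.dom, x ∈ ψ.dom → φ.eval x = ψ.eval x) :
    ∃ Φ : PartialMatching P, (∀ φ ∈ F, φ ≤ Φ) ∧ ∀ x ∈ Φ.dom, ∃ φ ∈ F, x ∈ φ.dom := by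
  classical
  let Q : LowerSet P := ⟨{x | ∃ φ ∈ F, x ∈ φ.dom}, fun x y hyx ⟨φ, hφ, hx⟩ =>
    ⟨φ, hφ, φ.dom.lower hyx hx⟩⟩
  let g : P → P := fun x => if h : ∃ φ ∈ F, x ∈ φ.dom then h.choose.eval x else x
  have hg : ∀ φ ∈ F, ∀ x ∈ φ.dom, g x = φ.eval x := by
    intro φ hφ x hx
    have h : ∃ φ ∈ F, x ∈ φ.dom := ⟨φ, hφ, hx⟩
    simp only [g, dif_pos h]
    exact hF _ h.choose_spec.1 _ hφ _ h.choose_spec.2 hx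
  have hQ : IsMatchingOn (Q : Set P) g := by
    refine ⟨?_, ?_, ?_, ?_⟩
    · rintro u ⟨φ, hφ, hu⟩
      rw [hg φ hφ u hu]
      exact ⟨φ, hφ, φ.isMatchingOn.mapsTo u hu⟩
    · rintro u ⟨φ, hφ, hu⟩
      rw [hg φ hφ u hu, hg φ hφ _ (φ.isMatchingOn.mapsTo u hu), φ.isMatchingOn.involutive u hu]
    · rintro u ⟨φ, hφ, hu⟩
      rw [hg φ hφ u hu]
      exact φ.isMatchingOn.covBy_or_covBy u hu
    · rintro u ⟨φ, hφ, hu⟩ hug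
      rw [hg φ hφ u hu] at hug ⊢
      rw [φ.isMatchingOn.coat_eq u hu hug]
      congr 1
      ext x
      refine exists_congr fun v => and_congr_right fun hvu => ?_
      rw [hg φ hφ v (φ.dom.lower hvu.le hu)]
  refine ⟨ofMatchingOn Q g hQ, fun φ hφ => le_iff.2 fun x hx => ?_, fun x hx => hx⟩
  have hxQ : x ∈ Q := ⟨φ, hφ, hx⟩
  exact ⟨hxQ, (eval_ofMatchingOn hQ hxQ).trans (hg φ hφ x hx)⟩

end PartialMatching

end Poset

/-! ### Partial matchings for the Bruhat order -/

namespace CoxeterSystem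

variable {B W : Type*} [Group W] {M : CoxeterMatrix B} {cs : CoxeterSystem M W}

theorem dihedral_simple_eq_parabolic (cs : CoxeterSystem M W) (r s : B) :
    dihedral (cs.simple r) (cs.simple s) = (cs.parabolic {r, s} : Set W) := by
  rw [dihedral, parabolic, Set.image_pair]

theorem dihedral_comm (s a : W) : dihedral s a = dihedral a s := by
  rw [dihedral, dihedral, Set.pair_comm]

/-- Below the length of a given element, a dihedral parabolic subgroup has two elements of each
positive length. -/
theorem exists_ne_of_length_lt {r s : B} {y : W} (hy : y ∈ cs.parabolic {r, s}) {m : ℕ}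
    (hm : 0 < m) (hmy : m < cs.length y) : ∃ v ∈ cs.parabolic {r, s}, ∃ w ∈ cs.parabolic {r, s},
      v ≠ w ∧ cs.length v = m ∧ cs.length w = m := by
  induction hn : cs.length y generalizing y with
  | zero => omega
  | succ n ih =>
    have hy1 : y ≠ 1 := by
      rintro rfl
      rw [cs.length_one] at hmy
      omega
    obtain ⟨i, hi⟩ := cs.exists_rightDescent_of_ne_one hy1
    have h1 := cs.isRightDescent_iff.1 hi
    have hyi := mul_mem hy (mem_parabolic_of_isRightDescent hy hi)
    by_cases hmn : m = n
    · have hyi1 : y * cs.simple i ≠ 1 := by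
        intro h
        rw [h, cs.length_one] at h1
        omega
      obtain ⟨l, hl⟩ := cs.exists_leftDescent_of_ne_one hyi1
      have h2 := cs.isLeftDescent_iff.1 hl
      have hl' := isLeftDescent_of_isLeftDescent_mul_simple hi hl
      have h3 := cs.isLeftDescent_iff.1 hl'
      refine ⟨_, hyi, _, mul_mem (mem_parabolic_of_isLeftDescent hy hl') hy, fun e => ?_,
        by omega, by omega⟩
      rw [e, simple_mul_simple_cancel_left] at h2
      omega
    · exact ih hyi (by omega) (by omega)

namespace IsBruhatOrder

variable [PartialOrder W] (hb : cs.IsBruhatOrder)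
include hb

theorem isLowerSet_dihedral {s a : W} (hs : s ∈ cs.generators) (ha : a ∈ cs.generators) :
    IsLowerSet (dihedral s a) := by
  obtain ⟨r, rfl⟩ := hs
  obtain ⟨i, rfl⟩ := ha
  rw [dihedral_simple_eq_parabolic]
  exact hb.isLowerSet_parabolic

theorem le_simple_iff {x : W} {i : B} : x ≤ cs.simple i ↔ x = 1 ∨ x = cs.simple i := by
  constructor
  · intro h
    rcases h.eq_or_lt with h | h
    · exact Or.inr h
    · have := hb.length_lt h
      rw [length_simple] at this
      exact Or.inl (cs.length_eq_zero_iff.1 (by omega))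
  · rintro (rfl | rfl)
    exacts [hb.one_le _, le_rfl]

/-- Outside a standard parabolic subgroup, an element that is not a simple reflection has a coatom
outside that subgroup: remove the first or the last letter. -/
theorem exists_covBy_notMem_parabolic {J : Set B} {w : W} (hw : w ∉ cs.parabolic J)
    (hw' : w ∉ cs.generators) : ∃ v, v ⋖ w ∧ v ∉ cs.parabolic J := by
  by_contra! h
  have hw1 : w ≠ 1 := by rintro rfl; exact hw (one_mem _)
  obtain ⟨i, hi⟩ := cs.exists_rightDescent_of_ne_one hw1
  have hwi := h _ (hb.mul_simple_covBy hi)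
  have hwi1 : w * cs.simple i ≠ 1 := fun e =>
    hw' ⟨i, by rw [mul_eq_one_iff_eq_inv.1 e, inv_simple]⟩
  obtain ⟨l, hl⟩ := cs.exists_leftDescent_of_ne_one hwi1
  have hlw := h _ (hb.simple_mul_covBy (isLeftDescent_of_isLeftDescent_mul_simple hi hl))
  exact hw (by simpa using mul_mem (mem_parabolic_of_isLeftDescent hwi hl) hlw)

/-- The map `x ↦ s i * x` is a matching of the interval `{1, s i}`. -/
theorem isMatchingOn_Iic_simple (i : B) :
    IsMatchingOn (LowerSet.Iic (cs.simple i) : Set W) (cs.simple i * ·) := by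
  have hcov : 1 ⋖ cs.simple i := hb.one_covBy_iff.2 ⟨i, rfl⟩
  have hQ : ∀ u ∈ (LowerSet.Iic (cs.simple i) : Set W), u = 1 ∨ u = cs.simple i :=
    fun u hu => hb.le_simple_iff.1 (by simpa using hu)
  refine ⟨fun u hu => ?_, fun u hu => by simp, fun u hu => ?_, fun u hu hcu => ?_⟩
  · rcases hQ u hu with rfl | rfl
    · simp
    · simpa using hb.one_le _
  · rcases hQ u hu with rfl | rfl
    · exact Or.inl (by simpa using hcov)
    · exact Or.inr (by simpa using hcov)
  · rcases hQ u hu with rfl | rfl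
    · ext x
      simp only [mul_one, Set.mem_union, Set.mem_singleton_iff, Set.mem_ofPred_eq]
      constructor
      · intro hx
        rcases hb.le_simple_iff.1 (CovBy.le hx) with h | h
        · exact Or.inl h
        · exact absurd h (CovBy.ne hx)
      · rintro (rfl | ⟨v, hv, -⟩)
        · exact hcov
        · exact absurd hv.lt (hb.one_le v).not_gt
    · have h := hcu.lt
      simp only [simple_mul_simple_self] at h
      exact absurd h (hb.one_le _).not_gt

/-- The smallest partial matching with `φ 1 = s i`. -/
def simpleMatching (i : B) : PartialMatching W :=
  .ofMatchingOn _ _ (hb.isMatchingOn_Iic_simple i)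

theorem mem_simpleMatching {i : B} {x : W} :
    x ∈ (hb.simpleMatching i).dom ↔ x = 1 ∨ x = cs.simple i :=
  hb.le_simple_iff

theorem eval_simpleMatching {i : B} {x : W} (hx : x = 1 ∨ x = cs.simple i) :
    (hb.simpleMatching i).eval x = cs.simple i * x :=
  PartialMatching.eval_ofMatchingOn (hb.isMatchingOn_Iic_simple i) (hb.le_simple_iff.2 hx)

variable {φ ψ : PartialMatching W}

theorem one_mem_dom {x : W} (hx : x ∈ φ.dom) : 1 ∈ φ.dom :=
  φ.dom.lower (hb.one_le x) hx

theorem eval_one_mem_generators (h : 1 ∈ φ.dom) : φ.eval 1 ∈ cs.generators := by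
  rcases φ.isMatchingOn.covBy_or_covBy 1 h with h1 | h1
  · exact hb.one_covBy_iff.1 h1
  · exact absurd h1.lt (hb.one_le _).not_gt

theorem one_mem_dom_of_isMax [Nonempty B] (hφ : IsMax φ) : 1 ∈ φ.dom := by
  by_contra h
  obtain ⟨i⟩ := ‹Nonempty B›
  have hle : φ ≤ hb.simpleMatching i :=
    PartialMatching.le_iff.2 fun x hx => absurd (hb.one_mem_dom hx) h
  exact h (PartialMatching.dom_subset_of_le (hφ hle) (hb.mem_simpleMatching.2 (Or.inl rfl)))

theorem eval_one_le_eval {u : W} (hu : u ∈ φ.dom) (hcov : u ⋖ φ.eval u) :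
    φ.eval 1 ≤ φ.eval u := by
  induction hn : cs.length u using Nat.strong_induction_on generalizing u with
  | _ n ih =>
    by_cases hu1 : u = 1
    · rw [hu1]
    obtain ⟨i, hi⟩ := cs.exists_rightDescent_of_ne_one hu1
    have hvu := hb.mul_simple_covBy hi
    set v := u * cs.simple i
    have hv : v ∈ φ.dom := φ.dom.lower hvu.le hu
    rcases φ.isMatchingOn.covBy_or_covBy v hv with h | h
    · refine (ih _ (hn ▸ hb.length_lt hvu.lt) hv h rfl).trans ?_
      have : φ.eval v ∈ coat (φ.eval u) := by
        rw [φ.isMatchingOn.coat_eq u hu hcov]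
        exact Or.inr ⟨v, hvu, h, rfl⟩
      exact this.le
    · have h1 := φ.isMatchingOn.involutive v hv
      have h2 := ih _ (hn ▸ hb.length_lt (h.lt.trans hvu.lt)) (φ.isMatchingOn.mapsTo v hv)
        (by rwa [h1]) rfl
      rw [h1] at h2
      exact h2.trans (hvu.le.trans hcov.le)

/-- Two partial matchings which agree on the principal dihedral subgroups agree wherever both are
defined. By induction, their values at an element which both move up have the same coatoms; so the
values are equal or lie in a common dihedral subgroup, which is principal because it contains
`φ 1`. -/
theorem eval_eq_eval_of_agree {a : W} (hφ : 1 ∈ φ.dom → φ.eval 1 = a)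
    (hd : ∀ s ∈ cs.generatorsNe a, ∀ x ∈ dihedral s a, x ∈ φ.dom → x ∈ ψ.dom →
      φ.eval x = ψ.eval x) {u : W} (hu : u ∈ φ.dom) (hu' : u ∈ ψ.dom) :
    φ.eval u = ψ.eval u := by
  induction hn : cs.length u using Nat.strong_induction_on generalizing u with
  | _ n ih =>
    have ih' : ∀ v, v < u → φ.eval v = ψ.eval v := fun v hv =>
      ih _ (hn ▸ hb.length_lt hv) (φ.dom.lower hv.le hu) (ψ.dom.lower hv.le hu') rfl
    have hφu := φ.isMatchingOn.involutive u hu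
    have hψu := ψ.isMatchingOn.involutive u hu'
    rcases φ.isMatchingOn.covBy_or_covBy u hu with h1 | h1
    swap
    · rw [ih' _ h1.lt] at hφu
      have h2 := ψ.isMatchingOn.involutive _ (ψ.dom.lower h1.le hu')
      rw [hφu] at h2
      exact h2.symm
    rcases ψ.isMatchingOn.covBy_or_covBy u hu' with h2 | h2
    swap
    · rw [← ih' _ h2.lt] at hψu
      have h3 := φ.isMatchingOn.involutive _ (φ.dom.lower h2.le hu)
      rwa [hψu] at h3
    have hcoat : coat (φ.eval u) = coat (ψ.eval u) := by
      rw [φ.isMatchingOn.coat_eq u hu h1, ψ.isMatchingOn.coat_eq u hu' h2]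
      congr 1
      ext x
      refine exists_congr fun v => and_congr_right fun hvu => ?_
      rw [ih' v hvu.lt]
    by_contra hne
    obtain ⟨r, s, hrs, hx, -⟩ := hb.exists_mem_parabolic_of_coat_eq hcoat hne
    have ha := hφ (hb.one_mem_dom hu)
    have hux : u ∈ cs.parabolic {r, s} := hb.isLowerSet_parabolic h1.le hx
    have hax := hb.isLowerSet_parabolic (hb.eval_one_le_eval hu h1) hx
    have hag := hb.eval_one_mem_generators (hb.one_mem_dom hu)
    rw [ha] at hax hag
    obtain ⟨i, rfl⟩ := hag
    obtain ⟨j, hj, hij⟩ := simple_mem_parabolic_iff.1 hax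
    rw [← SetLike.mem_coe, ← dihedral_simple_eq_parabolic] at hux
    rcases hj with rfl | rfl
    · rw [dihedral_comm, ← hij] at hux
      exact hne (hd _ ⟨⟨s, rfl⟩, by rw [hij]; exact hrs.symm⟩ u hux hu hu')
    · rw [← hij] at hux
      exact hne (hd _ ⟨⟨r, rfl⟩, by rw [hij]; exact hrs⟩ u hux hu hu')

/-- A partial matching preserves every standard parabolic subgroup that contains `φ 1`. -/
theorem eval_mem_parabolic {J : Set B} (h1 : φ.eval 1 ∈ cs.parabolic J) {u : W} (hu : u ∈ φ.dom)
    (huJ : u ∈ cs.parabolic J) : φ.eval u ∈ cs.parabolic J := by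
  induction hn : cs.length u using Nat.strong_induction_on generalizing u with
  | _ n ih =>
    rcases φ.isMatchingOn.covBy_or_covBy u hu with h | h
    swap
    · exact hb.isLowerSet_parabolic h.le huJ
    by_contra hw
    by_cases hg : φ.eval u ∈ cs.generators
    · obtain ⟨i, hi⟩ := hg
      rcases hb.le_simple_iff.1 (h.le.trans_eq hi.symm) with rfl | hu'
      · exact hw h1
      · exact h.ne (hu'.trans hi)
    · obtain ⟨v, hv, hvJ⟩ := hb.exists_covBy_notMem_parabolic hw hg
      have hv' : v ∈ coat (φ.eval u) := hv
      rw [φ.isMatchingOn.coat_eq u hu h] at hv'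
      rcases hv' with rfl | ⟨v, hvu, -, rfl⟩
      · exact hvJ huJ
      · exact hvJ (ih _ (hn ▸ hb.length_lt hvu.lt) (φ.dom.lower hvu.le hu)
          (hb.isLowerSet_parabolic hvu.le huJ) rfl)

/-- On a dihedral parabolic subgroup containing `φ 1`, exactly one element of each length moves up,
as long as the elements of that length belong to the domain and are not the longest ones. -/
theorem exists_unique_up {r s : B} (h1 : 1 ∈ φ.dom) (h1J : φ.eval 1 ∈ cs.parabolic {r, s}) {y : W}
    (hyJ : y ∈ cs.parabolic {r, s})
    (hy : ∀ x ∈ cs.parabolic {r, s}, cs.length x < cs.length y → x ∈ φ.dom) (k : ℕ)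
    (hk : k < cs.length y) :
    ∃ x ∈ cs.parabolic {r, s}, cs.length x = k ∧ x ⋖ φ.eval x ∧
      ∀ x' ∈ cs.parabolic {r, s}, cs.length x' = k → x' ≠ x → φ.eval x' ⋖ x' := by
  induction k with
  | zero =>
    refine ⟨1, one_mem _, cs.length_one, hb.one_covBy_iff.2 (hb.eval_one_mem_generators h1), ?_⟩
    exact fun x' _ hl hne => absurd (cs.length_eq_zero_iff.1 hl) hne
  | succ k ih =>
    obtain ⟨x, hxJ, hxl, hx, hxu⟩ := ih (by omega)
    have hxd := hy x hxJ (by omega)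
    have hgJ := hb.eval_mem_parabolic h1J hxd hxJ
    have hgl := (hb.covBy_iff_length_of_mem_parabolic_pair hxJ hgJ).1 hx
    have hgg := φ.isMatchingOn.involutive x hxd
    obtain ⟨z, hzJ, hzx, hzl⟩ : ∃ z ∈ cs.parabolic {r, s}, z ≠ φ.eval x ∧ cs.length z = k + 1 := by
      obtain ⟨v, hvJ, w, hwJ, hvw, hv, hw⟩ := exists_ne_of_length_lt hyJ k.succ_pos hk
      by_cases h : v = φ.eval x
      · exact ⟨w, hwJ, fun e => hvw (h.trans e.symm), hw⟩
      · exact ⟨v, hvJ, h, hv⟩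
    refine ⟨z, hzJ, hzl, ?_, fun x' hx'J hx'l hne => ?_⟩
    · have hzd := hy z hzJ (by omega)
      refine (φ.isMatchingOn.covBy_or_covBy z hzd).resolve_right fun h => ?_
      have hgzJ := hb.eval_mem_parabolic h1J hzd hzJ
      have h2 := (hb.covBy_iff_length_of_mem_parabolic_pair hgzJ hzJ).1 h
      have hzz := φ.isMatchingOn.involutive z hzd
      by_cases hgz : φ.eval z = x
      · exact hzx (by rw [← hgz, hzz])
      · have h3 := hxu _ hgzJ (by omega) hgz
        rw [hzz] at h3
        exact lt_asymm h.lt h3.lt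
    · have hx' : x' = φ.eval x :=
        (eq_or_eq_of_mem_parabolic_pair hzJ hgJ hx'J hzx (by omega) (by omega)).resolve_left hne
      rw [hx', hgg]
      exact hx

/-- A maximal matching is defined on every dihedral parabolic subgroup containing `φ 1`. Otherwise
let `y` be a missing element of minimal length. Exactly one element `x` one step below `y` moves up,
so the other element of the length of `y` is `φ x`, and setting `φ y = z` for an element `z` one
step above `y` extends the matching. -/
theorem mem_dom_of_isMax {r s : B} (hφ : IsMax φ) (h1 : 1 ∈ φ.dom)
    (h1J : φ.eval 1 ∈ cs.parabolic {r, s}) {y : W} (hyJ : y ∈ cs.parabolic {r, s}) :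
    y ∈ φ.dom := by
  classical
  induction hn : cs.length y using Nat.strong_induction_on generalizing y with
  | _ n ih =>
  have hlt : ∀ x ∈ cs.parabolic {r, s}, cs.length x < cs.length y → x ∈ φ.dom :=
    fun x hx hl => ih _ (hn ▸ hl) hx rfl
  clear ih
  subst hn
  by_contra hy
  have hyl : 0 < cs.length y := Nat.pos_of_ne_zero fun h => by
    rw [cs.length_eq_zero_iff.1 h] at hy
    exact hy h1
  obtain ⟨x, hxJ, hxl, hx, hxu⟩ :=
    hb.exists_unique_up h1 h1J hyJ hlt (cs.length y - 1) (by omega)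
  have hxd := hlt x hxJ (by omega)
  have hgJ := hb.eval_mem_parabolic h1J hxd hxJ
  have hgl := (hb.covBy_iff_length_of_mem_parabolic_pair hxJ hgJ).1 hx
  have hgd : φ.eval x ∈ φ.dom := φ.isMatchingOn.mapsTo x hxd
  have hgy : φ.eval x ≠ y := fun e => hy (e ▸ hgd)
  obtain ⟨z, hzJ, hzl⟩ := exists_length_succ_of_mem_parabolic_pair hgJ hyJ hgy (by omega)
  have hyz : y ⋖ z := (hb.covBy_iff_length_of_mem_parabolic_pair hyJ hzJ).2 hzl
  have hz : z ∉ φ.dom := fun h => hy (φ.dom.lower hyz.le h)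
  have hby : ∀ w, w < y → w ∈ φ.dom := fun w hw =>
    hlt w (hb.isLowerSet_parabolic hw.le hyJ) (hb.length_lt hw)
  have hbz : ∀ w, w < z → w = y ∨ w ∈ φ.dom := by
    intro w hw
    have hwJ : w ∈ cs.parabolic {r, s} := hb.isLowerSet_parabolic hw.le hzJ
    have hwl := hb.length_lt hw
    rcases (by omega : cs.length w < cs.length y ∨ cs.length w = cs.length y) with h | h
    · exact Or.inr (hlt w hwJ h)
    · rcases eq_or_eq_of_mem_parabolic_pair hgJ hyJ hwJ hgy (by omega) h with rfl | h'
      · exact Or.inr hgd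
      · exact Or.inl h'
  let Q : LowerSet W := ⟨{w | w ∈ φ.dom ∨ w = y ∨ w = z}, by
    rintro w v hvw (h | rfl | rfl)
    · exact Or.inl (φ.dom.lower hvw h)
    · rcases hvw.eq_or_lt with h | h
      · exact Or.inr (Or.inl h)
      · exact Or.inl (hby v h)
    · rcases hvw.eq_or_lt with h | h
      · exact Or.inr (Or.inr h)
      · rcases hbz v h with h | h
        exacts [Or.inr (Or.inl h), Or.inl h]⟩
  let g : W → W := fun w => if w = y then z else if w = z then y else φ.eval w
  have hgy' : g y = z := if_pos rfl
  have hgz' : g z = y := by simp [g, hyz.ne']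
  have hg : ∀ w ∈ φ.dom, g w = φ.eval w := by
    intro w hw
    have h2 : w ≠ y := fun e => hy (e ▸ hw)
    have h3 : w ≠ z := fun e => hz (e ▸ hw)
    simp [g, h2, h3]
  have hQ : IsMatchingOn (Q : Set W) g := by
    refine ⟨?_, ?_, ?_, ?_⟩
    · rintro u (hu | rfl | rfl)
      · rw [hg u hu]; exact Or.inl (φ.isMatchingOn.mapsTo u hu)
      · rw [hgy']; exact Or.inr (Or.inr rfl)
      · rw [hgz']; exact Or.inr (Or.inl rfl)
    · rintro u (hu | rfl | rfl)
      · rw [hg u hu, hg _ (φ.isMatchingOn.mapsTo u hu), φ.isMatchingOn.involutive u hu]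
      · rw [hgy', hgz']
      · rw [hgz', hgy']
    · rintro u (hu | rfl | rfl)
      · rw [hg u hu]; exact φ.isMatchingOn.covBy_or_covBy u hu
      · rw [hgy']; exact Or.inl hyz
      · rw [hgz']; exact Or.inr hyz
    · rintro u (hu | rfl | rfl) hug
      · rw [hg u hu] at hug ⊢
        rw [φ.isMatchingOn.coat_eq u hu hug]
        congr 1
        ext w
        refine exists_congr fun v => and_congr_right fun hvu => ?_
        rw [hg v (φ.dom.lower hvu.le hu)]
      · rw [hgy']
        ext w
        constructor
        · intro hw
          have hwJ : w ∈ cs.parabolic {r, s} := hb.isLowerSet_parabolic (CovBy.le hw) hzJ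
          have hwl := (hb.covBy_iff_length_of_mem_parabolic_pair hwJ hzJ).1 hw
          rcases eq_or_eq_of_mem_parabolic_pair hgJ hyJ hwJ hgy (by omega) (by omega) with h | h
          · refine Or.inr ⟨x, ?_, by rwa [hg x hxd], by rw [hg x hxd, h]⟩
            exact (hb.covBy_iff_length_of_mem_parabolic_pair hxJ hyJ).2 (by omega)
          · exact Or.inl h
        · rintro (rfl | ⟨v, hvu, hv, rfl⟩)
          · exact hyz
          · have hvd := hby v hvu.lt
            have hvJ : v ∈ cs.parabolic {r, s} := hb.isLowerSet_parabolic hvu.le hyJ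
            have hvl := (hb.covBy_iff_length_of_mem_parabolic_pair hvJ hyJ).1 hvu
            rw [hg v hvd] at hv ⊢
            have hvx : v = x := by
              by_contra hne
              exact lt_asymm hv.lt (hxu v hvJ (by omega) hne).lt
            rw [hvx]
            exact (hb.covBy_iff_length_of_mem_parabolic_pair hgJ hzJ).2 (by omega)
      · rw [hgz'] at hug
        exact absurd hug.lt hyz.lt.not_gt
  have hle : φ ≤ .ofMatchingOn Q g hQ := PartialMatching.le_iff.2 fun w hw =>
    ⟨Or.inl hw, (PartialMatching.eval_ofMatchingOn hQ (Or.inl hw)).trans (hg w hw)⟩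
  exact hy (PartialMatching.dom_subset_of_le (hφ hle) (Or.inr (Or.inl rfl)))

end IsBruhatOrder

end CoxeterSystem

/-! ### Maximal matchings and their restrictions to the principal dihedral subgroups -/

namespace CoxeterSystem

variable {B W : Type*} [Group W] {M : CoxeterMatrix B} {cs : CoxeterSystem M W}

theorem mem_dihedral_right (s a : W) : a ∈ dihedral s a :=
  Subgroup.subset_closure (Set.mem_insert_of_mem s rfl)

/-- Distinct principal dihedral subgroups meet in `{1, a}`: an element of the intersection has no
right descent other than `a`. -/
theorem eq_one_or_eq_of_mem_dihedral {s t a x : W} (hst : s ≠ t) (ha : a ∈ cs.generators)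
    (hs : s ∈ cs.generators) (ht : t ∈ cs.generators) (hxs : x ∈ dihedral s a)
    (hxt : x ∈ dihedral t a) : x = 1 ∨ x = a := by
  obtain ⟨i, rfl⟩ := ha
  obtain ⟨r, rfl⟩ := hs
  obtain ⟨q, rfl⟩ := ht
  rw [dihedral_simple_eq_parabolic, SetLike.mem_coe] at hxs hxt
  have key : ∀ y ∈ cs.parabolic {r, i}, y ∈ cs.parabolic {q, i} → y ≠ 1 →
      cs.IsRightDescent y i := by
    intro y hy hy' hne
    obtain ⟨l, hl⟩ := cs.exists_rightDescent_of_ne_one hne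
    obtain ⟨j, hj, e⟩ := simple_mem_parabolic_iff.1 (mem_parabolic_of_isRightDescent hy hl)
    obtain ⟨k, hk, e'⟩ := simple_mem_parabolic_iff.1 (mem_parabolic_of_isRightDescent hy' hl)
    rw [IsRightDescent] at hl ⊢
    rcases hj with rfl | rfl
    · rcases hk with rfl | rfl
      · exact absurd (e.symm.trans e') hst
      · rwa [← e']
    · rwa [← e]
  by_cases hx1 : x = 1
  · exact Or.inl hx1
  right
  have hx := key x hxs hxt hx1
  by_contra hne
  have hxi1 : x * cs.simple i ≠ 1 := fun e => hne (by rw [mul_eq_one_iff_eq_inv.1 e, inv_simple])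
  exact cs.isRightDescent_iff_not_isRightDescent_mul.1 hx
    (key _ (mul_mem hxs (simple_mem_parabolic (by simp)))
      (mul_mem hxt (simple_mem_parabolic (by simp))) hxi1)

end CoxeterSystem

theorem PartialMatching.restrictsTo_iff {P : Type*} [PartialOrder P] {φ : PartialMatching P}
    {D : Set P} {f : D → D} :
    φ.RestrictsTo D f ↔ ∀ x : D, (x : P) ∈ φ.dom ∧ φ.eval x = f x :=
  forall_congr' fun _ => maps_iff

theorem PartialMatching.RestrictsTo.unique {P : Type*} [PartialOrder P] {φ : PartialMatching P}
    {D : Set P} {f g : D → D} (hf : φ.RestrictsTo D f) (hg : φ.RestrictsTo D g) : f = g :=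
  funext fun x => Subtype.ext ((restrictsTo_iff.1 hf x).2.symm.trans (restrictsTo_iff.1 hg x).2)

namespace CoxeterSystem.IsBruhatOrder

variable {B W : Type*} [Group W] {M : CoxeterMatrix B} {cs : CoxeterSystem M W}
variable [PartialOrder W] (hb : cs.IsBruhatOrder)
include hb

theorem exists_maps_one_of_isMax [Nonempty B] {φ : PartialMatching W} (hφ : IsMax φ) :
    ∃ a ∈ cs.generators, φ.Maps 1 a :=
  ⟨φ.eval 1, hb.eval_one_mem_generators (hb.one_mem_dom_of_isMax hφ),
    PartialMatching.maps_iff.2 ⟨hb.one_mem_dom_of_isMax hφ, rfl⟩⟩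

theorem exists_restrictsTo_of_isMax {φ : PartialMatching W} (hφ : IsMax φ) {a s : W}
    (ha : φ.Maps 1 a) (hs : s ∈ cs.generatorsNe a) :
    ∃ f : dihedral s a → dihedral s a,
      IsDistinguishedMatching f ∧ φ.RestrictsTo (dihedral s a) f := by
  obtain ⟨h1, ha⟩ := PartialMatching.maps_iff.1 ha
  have hag := hb.eval_one_mem_generators h1
  rw [ha] at hag
  have hlow := hb.isLowerSet_dihedral hs.1 hag
  obtain ⟨hdom, hmaps⟩ : (∀ x ∈ dihedral s a, x ∈ φ.dom) ∧
      ∀ x ∈ dihedral s a, φ.eval x ∈ dihedral s a := by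
    obtain ⟨⟨r, rfl⟩, -⟩ := hs
    obtain ⟨i, rfl⟩ := hag
    have h1J : φ.eval 1 ∈ cs.parabolic {r, i} := by
      rw [ha]
      exact simple_mem_parabolic (by simp)
    rw [dihedral_simple_eq_parabolic]
    have hdom : ∀ x ∈ cs.parabolic {r, i}, x ∈ φ.dom := fun x hx => hb.mem_dom_of_isMax hφ h1 h1J hx
    exact ⟨hdom, fun x hx => hb.eval_mem_parabolic h1J (hdom x hx) hx⟩
  refine ⟨fun x => ⟨φ.eval x, hmaps x x.2⟩, ?_,
    PartialMatching.restrictsTo_iff.2 fun x => ⟨hdom x x.2, rfl⟩⟩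
  refine (isDistinguishedMatching_iff_isMatchingOn hlow (g := φ.eval) fun _ => rfl).2 ?_
  exact ⟨hmaps, fun u hu => φ.isMatchingOn.involutive u (hdom u hu),
    fun u hu => φ.isMatchingOn.covBy_or_covBy u (hdom u hu),
    fun u hu => φ.isMatchingOn.coat_eq u (hdom u hu)⟩

variable {a : W} {α : (s : cs.generatorsNe a) → dihedral s.1 a → dihedral s.1 a}

/-- A maximal matching with prescribed restrictions takes the prescribed value `a` at `1`, even when
there are no principal dihedral subgroups to prescribe it on. -/
theorem maps_one_of_restrictsTo (ha : a ∈ cs.generators)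
    (hα1 : ∀ s : cs.generatorsNe a, (α s ⟨1, one_mem_dihedral s.1 a⟩ : W) = a)
    {φ : PartialMatching W} (hφ : IsMax φ)
    (hr : ∀ s : cs.generatorsNe a, φ.RestrictsTo (dihedral s.1 a) (α s)) : φ.Maps 1 a := by
  have : Nonempty B := ⟨ha.choose⟩
  obtain ⟨b, hbg, hφb⟩ := hb.exists_maps_one_of_isMax hφ
  by_cases hba : b = a
  · rwa [← hba]
  · have h := hr ⟨b, hbg, hba⟩ ⟨1, one_mem_dihedral b a⟩
    rwa [hα1] at h

/-- Prescribed matchings of the principal dihedral subgroups, all sending `1` to `a`, extend to a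
unique maximal matching: the union of all partial matchings compatible with them. -/
theorem existsUnique_isMax_restrictsTo (ha : a ∈ cs.generators)
    (hα : ∀ s : cs.generatorsNe a, IsDistinguishedMatching (α s))
    (hα1 : ∀ s : cs.generatorsNe a, (α s ⟨1, one_mem_dihedral s.1 a⟩ : W) = a) :
    ∃! φ : PartialMatching W, IsMax φ ∧
      ∀ s : cs.generatorsNe a, φ.RestrictsTo (dihedral s.1 a) (α s) := by
  -- The partial matchings compatible with the data; their union is the required matching.
  let F : Set (PartialMatching W) := {φ | (1 ∈ φ.dom → φ.eval 1 = a) ∧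
    ∀ (s : cs.generatorsNe a) (x : dihedral s.1 a), (x : W) ∈ φ.dom → φ.eval x = α s x}
  have hF : ∀ φ ∈ F, ∀ ψ ∈ F, ∀ x ∈ φ.dom, x ∈ ψ.dom → φ.eval x = ψ.eval x :=
    fun φ hφ ψ hψ x hx hx' => hb.eval_eq_eval_of_agree hφ.1
      (fun s hs y hy h h' => (hφ.2 ⟨s, hs⟩ ⟨y, hy⟩ h).trans (hψ.2 ⟨s, hs⟩ ⟨y, hy⟩ h').symm) hx hx'
  obtain ⟨Φ, hΦ, -⟩ := PartialMatching.exists_union F hF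
  have hαa : ∀ s : cs.generatorsNe a, (α s ⟨a, mem_dihedral_right s.1 a⟩ : W) = 1 := by
    intro s
    have h : α s ⟨1, one_mem_dihedral s.1 a⟩ = ⟨a, mem_dihedral_right s.1 a⟩ :=
      Subtype.ext (hα1 s)
    rw [← h, (hα s).involutive]
  obtain ⟨i, hi⟩ := id ha
  have hsimple : hb.simpleMatching i ∈ F := by
    refine ⟨fun _ => by rw [hb.eval_simpleMatching (Or.inl rfl), mul_one, hi], ?_⟩
    rintro s ⟨x, hxs⟩ hx
    rw [hb.mem_simpleMatching] at hx
    rw [hb.eval_simpleMatching hx]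
    rcases hx with rfl | rfl
    · rw [hα1, mul_one, hi]
    · subst hi
      rw [hαa, simple_mul_simple_self]
  let A : cs.generatorsNe a → PartialMatching W := fun s =>
    ⟨⟨dihedral s.1 a, hb.isLowerSet_dihedral s.2.1 ha⟩, α s, hα s⟩
  have hA : ∀ (s : cs.generatorsNe a) (x : dihedral s.1 a), (A s).eval x = α s x :=
    fun s x => (A s).eval_coe x
  have hAF : ∀ s, A s ∈ F := by
    intro s
    refine ⟨fun _ => (hA s ⟨1, one_mem_dihedral s.1 a⟩).trans (hα1 s), ?_⟩
    rintro t ⟨x, hxt⟩ hxs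
    by_cases hst : s = t
    · subst hst
      exact hA s ⟨x, hxt⟩
    rw [hA s ⟨x, hxs⟩]
    change x ∈ dihedral s.1 a at hxs
    rcases eq_one_or_eq_of_mem_dihedral (fun e => hst (Subtype.ext e)) ha s.2.1 t.2.1 hxs hxt
      with rfl | rfl
    · rw [hα1, hα1]
    · rw [hαa, hαa]
  have h1 : 1 ∈ Φ.dom :=
    PartialMatching.dom_subset_of_le (hΦ _ hsimple) (hb.mem_simpleMatching.2 (Or.inl rfl))
  have hΦr : ∀ s : cs.generatorsNe a, Φ.RestrictsTo (dihedral s.1 a) (α s) := fun s =>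
    hΦ _ (hAF s)
  have hΦ1 : Φ.eval 1 = a := by
    rw [PartialMatching.eval_eq_eval_of_le (hΦ _ hsimple) (hb.mem_simpleMatching.2 (Or.inl rfl)),
      hb.eval_simpleMatching (Or.inl rfl), mul_one, hi]
  refine ⟨Φ, ⟨fun ψ hψ => hΦ ψ ⟨fun _ => ?_, fun s x _ => ?_⟩, hΦr⟩, ?_⟩
  · rw [PartialMatching.eval_eq_eval_of_le hψ h1, hΦ1]
  · obtain ⟨h, h'⟩ := PartialMatching.restrictsTo_iff.1 (hΦr s) x
    rw [PartialMatching.eval_eq_eval_of_le hψ h, h']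
  · rintro ψ ⟨hψ, hψr⟩
    have hle : ψ ≤ Φ := hΦ ψ
      ⟨fun _ => (PartialMatching.maps_iff.1 (hb.maps_one_of_restrictsTo ha hα1 hψ hψr)).2,
        fun s x _ => (PartialMatching.restrictsTo_iff.1 (hψr s) x).2⟩
    exact le_antisymm hle (hψ hle)

/-- Restriction to the principal dihedral subgroups is a bijection from the maximal matchings with
`φ 1 = a` to the families of matchings of these subgroups with value `a` at `1`. -/
theorem exists_equiv_restrictsTo (ha : a ∈ cs.generators) :
    ∃ r : {φ : PartialMatching W // IsMax φ ∧ φ.Maps 1 a} ≃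
        ((s : cs.generatorsNe a) → {f : dihedral s.1 a → dihedral s.1 a //
          IsDistinguishedMatching f ∧ (f ⟨1, one_mem_dihedral s.1 a⟩ : W) = a}),
      ∀ (φ : {φ : PartialMatching W // IsMax φ ∧ φ.Maps 1 a}) (s : cs.generatorsNe a),
        φ.1.RestrictsTo (dihedral s.1 a) (r φ s).1 := by
  have hex : ∀ (φ : {φ : PartialMatching W // IsMax φ ∧ φ.Maps 1 a}) (s : cs.generatorsNe a),
      ∃ f : {f : dihedral s.1 a → dihedral s.1 a //
        IsDistinguishedMatching f ∧ (f ⟨1, one_mem_dihedral s.1 a⟩ : W) = a},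
        φ.1.RestrictsTo (dihedral s.1 a) f.1 := by
    intro φ s
    obtain ⟨f, hf, hr⟩ := hb.exists_restrictsTo_of_isMax φ.2.1 φ.2.2 s.2
    refine ⟨⟨f, hf, ?_⟩, hr⟩
    have h := PartialMatching.restrictsTo_iff.1 hr ⟨1, one_mem_dihedral s.1 a⟩
    exact h.2.symm.trans (PartialMatching.maps_iff.1 φ.2.2).2
  choose r hr using hex
  refine ⟨Equiv.ofBijective r ⟨fun φ ψ h => ?_, fun β => ?_⟩, hr⟩
  · have hu := hb.existsUnique_isMax_restrictsTo ha (fun s => (r φ s).2.1) fun s => (r φ s).2.2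
    exact Subtype.ext (hu.unique ⟨φ.2.1, hr φ⟩ ⟨ψ.2.1, fun s => h ▸ hr ψ s⟩)
  · obtain ⟨φ, ⟨hφ, hφr⟩, -⟩ :=
      hb.existsUnique_isMax_restrictsTo ha (fun s => (β s).2.1) fun s => (β s).2.2
    have h1 := hb.maps_one_of_restrictsTo ha (fun s => (β s).2.2) hφ hφr
    exact ⟨⟨φ, hφ, h1⟩, funext fun s => Subtype.ext ((hr ⟨φ, hφ, h1⟩ s).unique (hφr s))⟩

end CoxeterSystem.IsBruhatOrder

theorem mainTheorem4 {B W : Type*} [Group W] {M : CoxeterMatrix B} (cs : CoxeterSystem M W) :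
    letI : PartialOrder W := cs.bruhatOrder
    -- a maximal matching is defined at the identity, with value a simple generator
    (∀ φ : PartialMatching W, IsMax φ → Nonempty B → ∃ a ∈ cs.generators, φ.Maps 1 a) ∧
    -- every principal dihedral subgroup is stable, and the induced map is a matching
    (∀ φ : PartialMatching W, IsMax φ → ∀ a : W, φ.Maps 1 a → ∀ s ∈ cs.generatorsNe a,
      ∃ f : dihedral s a → dihedral s a,
        IsDistinguishedMatching f ∧ φ.RestrictsTo (dihedral s a) f) ∧
    -- every family of matchings of the principal dihedral subgroups extends uniquely
    (∀ a ∈ cs.generators,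
      ∀ α : (s : cs.generatorsNe a) → dihedral s.1 a → dihedral s.1 a,
        (∀ s : cs.generatorsNe a, IsDistinguishedMatching (α s)) →
        (∀ s : cs.generatorsNe a, (α s ⟨1, one_mem_dihedral s.1 a⟩ : W) = a) →
        ∃! φ : PartialMatching W, IsMax φ ∧
          ∀ s : cs.generatorsNe a, φ.RestrictsTo (dihedral s.1 a) (α s)) ∧
    -- restriction is a bijection onto the cartesian product
    (∀ a ∈ cs.generators,
      ∃ r : {φ : PartialMatching W // IsMax φ ∧ φ.Maps 1 a} ≃
          ((s : cs.generatorsNe a) →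
            {f : dihedral s.1 a → dihedral s.1 a //
              IsDistinguishedMatching f ∧ (f ⟨1, one_mem_dihedral s.1 a⟩ : W) = a}),
        ∀ (φ : {φ : PartialMatching W // IsMax φ ∧ φ.Maps 1 a}) (s : cs.generatorsNe a),
          φ.1.RestrictsTo (dihedral s.1 a) (r φ s).1) := by
  let _ : PartialOrder W := cs.bruhatOrder
  have hb : cs.IsBruhatOrder := fun _ _ => Iff.rfl
  exact ⟨fun φ hφ _ => hb.exists_maps_one_of_isMax hφ,
    fun φ hφ a ha s hs => hb.exists_restrictsTo_of_isMax hφ ha hs,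
    fun a ha α hα hα1 => hb.existsUnique_isMax_restrictsTo ha hα hα1,
    fun a ha => hb.exists_equiv_restrictsTo ha⟩
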